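/- In the Orthogonal Vectors problem ($\mathsf{OV}$) one is given $n \ge 1$, $d \ge 0$ and vectors $u_1,\dots,u_n,v_1,\dots,v_n\in\{0,1\}^d$, and must decide whether there are $i,j\in\{1,\dots,n\}$ with $\langle u_i,v_j\rangle=0$, the inner product being taken over $\mathbb Z$. **Corollary.** The problem $\mathsf{OV}$ can be solved deterministically in time $\tilde O(n\cdot 1.155^d)$. That is, there are a single deterministic random-access-machine program (with time measured by logarithmic cost: each step is charged $1$ plus the bit lengths of the numbers and memory addresses it reads) and constants $C$ and $k$ such that, for all $n\ge 1$, all $d\ge 0$ and all $u_1,\dots,u_n,v_1,\dots,v_n\in\{0,1\}^d$ (given bit by bit in memory, which is otherwise zero), the program halts with the correct answer within time $C\cdot T\cdot(1+\log T)^k$, where $T=n\cdot 1.155^d$. -/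

import Mathlib

namespace LogRAM

/-- Deterministic programs of a random access machine. The machine has registers and a random
access memory, both indexed by the natural numbers and holding natural numbers. Register indices
and the literals of `const` are part of the program text, hence fixed once and for all. -/
inductive Prog : Type
  /-- do nothing -/
  | skip : Prog
  /-- `reg r := c` -/
  | const (r c : ℕ) : Prog
  /-- `reg r := reg s` -/
  | copy (r s : ℕ) : Prog
  /-- `reg r := reg s + reg t` -/
  | add (r s t : ℕ) : Prog
  /-- `reg r := reg s - reg t`, truncated at `0` -/
  | sub (r s t : ℕ) : Prog
  /-- `reg r := reg s * reg t` -/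
  | mul (r s t : ℕ) : Prog
  /-- `reg r := ⌊reg s / reg t⌋`, and `0` if `reg t = 0` -/
  | div (r s t : ℕ) : Prog
  /-- `reg r := mem (reg s)` -/
  | load (r s : ℕ) : Prog
  /-- `mem (reg r) := reg s` -/
  | store (r s : ℕ) : Prog
  /-- run `p`, then `q` -/
  | seq (p q : Prog) : Prog
  /-- if `reg r ≠ 0` then run `p`, else run `q` -/
  | cond (r : ℕ) (p q : Prog) : Prog
  /-- while `reg r ≠ 0`, run `p` -/
  | loop (r : ℕ) (p : Prog) : Prog

/-- A configuration of the machine: contents of the registers and of the memory. -/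
@[ext] structure State where
  reg : ℕ → ℕ
  mem : ℕ → ℕ

/-- The state after writing `x` into register `r`. -/
def State.setReg (σ : State) (r x : ℕ) : State := ⟨Function.update σ.reg r x, σ.mem⟩

/-- The state after writing `x` into memory cell `a`. -/
def State.setMem (σ : State) (a x : ℕ) : State := ⟨σ.reg, Function.update σ.mem a x⟩

/-- `Exec p σ t τ`: started in state `σ`, the program `p` halts in state `τ` after time `t`.
Time is the logarithmic cost: every executed instruction and every evaluated test costs `1` plus
the bit lengths (`Nat.size`) of the numbers that it reads (operands and memory addresses); the
literal of `const` is charged in the same way. The number written by an instruction is no longer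
than the numbers read together, plus one bit. -/
inductive Exec : Prog → State → ℕ → State → Prop
  | skip (σ : State) : Exec .skip σ 1 σ
  | const (r c : ℕ) (σ : State) : Exec (.const r c) σ (1 + c.size) (σ.setReg r c)
  | copy (r s : ℕ) (σ : State) :
      Exec (.copy r s) σ (1 + (σ.reg s).size) (σ.setReg r (σ.reg s))
  | add (r s t : ℕ) (σ : State) :
      Exec (.add r s t) σ (1 + (σ.reg s).size + (σ.reg t).size)
        (σ.setReg r (σ.reg s + σ.reg t))
  | sub (r s t : ℕ) (σ : State) :
      Exec (.sub r s t) σ (1 + (σ.reg s).size + (σ.reg t).size)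
        (σ.setReg r (σ.reg s - σ.reg t))
  | mul (r s t : ℕ) (σ : State) :
      Exec (.mul r s t) σ (1 + (σ.reg s).size + (σ.reg t).size)
        (σ.setReg r (σ.reg s * σ.reg t))
  | div (r s t : ℕ) (σ : State) :
      Exec (.div r s t) σ (1 + (σ.reg s).size + (σ.reg t).size)
        (σ.setReg r (σ.reg s / σ.reg t))
  | load (r s : ℕ) (σ : State) :
      Exec (.load r s) σ (1 + (σ.reg s).size + (σ.mem (σ.reg s)).size)
        (σ.setReg r (σ.mem (σ.reg s)))
  | store (r s : ℕ) (σ : State) :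
      Exec (.store r s) σ (1 + (σ.reg r).size + (σ.reg s).size)
        (σ.setMem (σ.reg r) (σ.reg s))
  | seq {p q : Prog} {σ τ ρ : State} {t t' : ℕ} :
      Exec p σ t τ → Exec q τ t' ρ → Exec (.seq p q) σ (t + t') ρ
  | cond_true {r : ℕ} {p q : Prog} {σ τ : State} {t : ℕ} :
      σ.reg r ≠ 0 → Exec p σ t τ → Exec (.cond r p q) σ (1 + (σ.reg r).size + t) τ
  | cond_false {r : ℕ} {p q : Prog} {σ τ : State} {t : ℕ} :
      σ.reg r = 0 → Exec q σ t τ → Exec (.cond r p q) σ (1 + (σ.reg r).size + t) τ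
  | loop_true {r : ℕ} {p : Prog} {σ τ ρ : State} {t t' : ℕ} :
      σ.reg r ≠ 0 → Exec p σ t τ → Exec (.loop r p) τ t' ρ →
        Exec (.loop r p) σ (1 + (σ.reg r).size + t + t') ρ
  | loop_false {r : ℕ} {p : Prog} {σ : State} :
      σ.reg r = 0 → Exec (.loop r p) σ (1 + (σ.reg r).size) σ

/-- The machine is deterministic: the running time and the final state are determined by the
program and the initial state. -/
theorem Exec.deterministic {p : Prog} {σ τ τ' : State} {t t' : ℕ}
    (h : Exec p σ t τ) (h' : Exec p σ t' τ') : t = t' ∧ τ = τ' := by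
  induction h generalizing t' τ' with
  | seq _ _ ih₁ ih₂ =>
    cases h' with
    | seq k₁ k₂ =>
      obtain ⟨rfl, rfl⟩ := ih₁ k₁
      obtain ⟨rfl, rfl⟩ := ih₂ k₂
      exact ⟨rfl, rfl⟩
  | cond_true hr _ ih =>
    cases h' with
    | cond_true _ k =>
      obtain ⟨rfl, rfl⟩ := ih k
      exact ⟨rfl, rfl⟩
    | cond_false h0 _ => exact absurd h0 hr
  | cond_false hr _ ih =>
    cases h' with
    | cond_true h0 _ => exact absurd hr h0
    | cond_false _ k =>
      obtain ⟨rfl, rfl⟩ := ih k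
      exact ⟨rfl, rfl⟩
  | loop_true hr _ _ ih₁ ih₂ =>
    cases h' with
    | loop_true _ k₁ k₂ =>
      obtain ⟨rfl, rfl⟩ := ih₁ k₁
      obtain ⟨rfl, rfl⟩ := ih₂ k₂
      exact ⟨rfl, rfl⟩
    | loop_false h0 => exact absurd h0 hr
  | loop_false hr =>
    cases h' with
    | loop_true h0 _ _ => exact absurd hr h0
    | loop_false _ => exact ⟨rfl, rfl⟩
  | _ => cases h'; exact ⟨rfl, rfl⟩

end LogRAM

namespace OrthogonalVectors

open LogRAM

/-- The Orthogonal Vectors predicate for vectors `u₁, …, uₙ, v₁, …, vₙ ∈ {0,1}^d`: some `uᵢ` and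
`vⱼ` have inner product `0` over the integers. -/
def HasOrthogonalPair {n d : ℕ} (u v : Fin n → Fin d → Bool) : Prop :=
  ∃ i j : Fin n, ∑ k : Fin d, ((u i k).toNat : ℤ) * ((v j k).toNat : ℤ) = 0

/-- The initial state for the instance `(u, v)`: register `0` holds `n`, register `1` holds `d`,
the memory cells `0, …, 2nd - 1` hold the bits of `u₁, …, uₙ, v₁, …, vₙ` in this order, one bit
per cell, and everything else is `0`. -/
def initState {n d : ℕ} (u v : Fin n → Fin d → Bool) : State where
  reg r := if r = 0 then n else if r = 1 then d else 0
  mem a :=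
    if (∃ (i : Fin n) (k : Fin d), a = i * d + k ∧ u i k = true) ∨
        (∃ (i : Fin n) (k : Fin d), a = n * d + i * d + k ∧ v i k = true)
    then 1 else 0

open Classical in
/-- The program `p` solves the Orthogonal Vectors problem within time `T n d`: on every instance
with `n ≥ 1` vectors on each side and dimension `d` it halts within time `T n d`, and then
register `0` holds `1` if there is an orthogonal pair and `0` otherwise. -/
def SolvesInTime (p : Prog) (T : ℕ → ℕ → ℝ) : Prop :=
  ∀ n d : ℕ, 1 ≤ n → ∀ u v : Fin n → Fin d → Bool,
    ∃ (t : ℕ) (τ : State), Exec p (initState u v) t τ ∧ (t : ℝ) ≤ T n d ∧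
      τ.reg 0 = if HasOrthogonalPair u v then 1 else 0

end OrthogonalVectors

/-! Vectors are orthogonal exactly when their supports are disjoint. Over a ground set of constant
size `s`, a set `W` yields a biclique of the disjointness relation: every `u ⊆ W` is disjoint from
every `v` that avoids `W`. `exists_biclique_cover` covers the whole relation by `M` bicliques in
such a way that each `u` and each `v` lies in at most `k ≤ 1.155 ^ s` of them. The number `M` is a
constant of arbitrary size.

Cut vectors of length `d` into `m = d / s + 1` blocks. A vector then has `k ^ m` choices of one
biclique per block, and two vectors are orthogonal iff some choice for the first agrees with some
choice for the second in every block (`exists_code_eq_iff`). A choice is encoded as a number in base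
`M`. The program marks the memory cells addressed by the codes of all `u i`, then looks up the codes
of all `v j`. The work is `n * k ^ m ≤ k * n * 1.155 ^ d` codes. The finite table of the cover is
part of the program text, so its mere existence is enough. Addresses may be exponential in `d`, but
their bit length is `O(log n + d)`.

The cover comes from sampling. For `|u| = a`, `|v| = b` and `g = s - a - b`, draw `W` uniformly
among the sets of size `a + x`, where `x + y = g`. The events `u ⊆ W` with `W ∩ v = ∅`, `u ⊆ W`
alone, and `W ∩ v = ∅` alone have probabilities proportional to `C(g, x)`, `C(g + b, x)` and `C(g +
a, y)`. Sampling until every disjoint pair is separated puts each set in about the ratio of its own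
event to the joint one, up to a factor polynomial in `s` (`exists_hitting_finset`). So `x` must make
both ratios at most about `coverRate ^ s` (`exists_balanced_choose`). For every `x` one of the two
ratios is small, because a suitable weighted mean of their logarithms is (`weighted_log_ratio_le`);
a discrete continuity argument in `x` then finds a point where both are. Since `coverRate < 1.155`,
a large constant `s` absorbs all polynomial factors. -/

/-! ### Entropy bounds for binomial coefficients -/

-- A single term of the expansion of `(τ + (1 - τ)) ^ (x + z) = 1` is at most `1`. The bound is
-- linear in `x` and `z`, with `τ` left free for optimisation.
open Real in
theorem log_choose_le (x z : ℕ) {τ : ℝ} (h0 : 0 < τ) (h1 : τ < 1) :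
    log ((x + z).choose x) ≤ -(x * log τ) - z * log (1 - τ) := by
  have h2 : (0 : ℝ) < 1 - τ := by linarith
  have hle : τ ^ x * (1 - τ) ^ z * ((x + z).choose x : ℝ) ≤ 1 := by
    have h := add_pow τ (1 - τ) (x + z)
    rw [add_sub_cancel, one_pow] at h
    have := Finset.single_le_sum (s := Finset.range (x + z + 1))
      (f := fun m => τ ^ m * (1 - τ) ^ (x + z - m) * ((x + z).choose m : ℝ))
      (fun i _ => by positivity) (a := x) (by simp)
    rw [Nat.add_sub_cancel_left] at this
    exact this.trans h.ge
  have hc : (0 : ℝ) < (x + z).choose x := by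
    exact_mod_cast Nat.choose_pos (by omega)
  have := log_le_log (by positivity) hle
  rw [log_one, log_mul (by positivity) hc.ne', log_mul (by positivity) (by positivity), log_pow,
    log_pow] at this
  linarith

/-- Among the `x + y + 1` terms of the binomial expansion of `(x + y) ^ (x + y)`, the one with
exponent `x` is the largest: by `step`, consecutive terms increase up to index `x` and decrease
afterwards. -/
theorem add_pow_le_choose_mul (x y : ℕ) :
    (x + y) ^ (x + y) ≤ (x + y + 1) * ((x + y).choose x * x ^ x * y ^ y) := by
  set g := x + y with hg
  set t : ℕ → ℕ := fun k => x ^ k * y ^ (g - k) * g.choose k with ht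
  have step : ∀ k < g, t (k + 1) * ((k + 1) * y) = t k * ((g - k) * x) := by
    intro k hk
    have h1 := Nat.choose_succ_right_eq g k
    have h2 : g - k = (g - (k + 1)) + 1 := by omega
    simp only [ht]
    calc _ = x ^ (k + 1) * (y ^ (g - (k + 1)) * y) * (g.choose (k + 1) * (k + 1)) := by ring
      _ = x ^ (k + 1) * y ^ (g - k) * (g.choose k * (g - k)) := by
        rw [h1, ← pow_succ, ← h2]
      _ = _ := by ring
  have key : ∀ k ≤ g, t k ≤ t x := by
    rcases Nat.eq_zero_or_pos y with hy | hy
    · intro k hk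
      rcases hk.lt_or_eq with h | h
      · simp [ht, hy, show g - k ≠ 0 by omega]
      · rw [h, hg, hy]; simp
    rcases Nat.eq_zero_or_pos x with hx | hx
    · intro k hk
      rcases Nat.eq_zero_or_pos k with h | h
      · rw [h, hx]
      · simp [ht, hx, show k ≠ 0 by omega]
    intro k hk
    rcases le_total k x with h | h
    · induction h using Nat.decreasingInduction with
      | self => exact le_rfl
      | of_succ k hkx ih =>
        refine le_trans ?_ (ih (by omega))
        have h3 : (k + 1) * y ≤ (g - k) * x := by
          calc (k + 1) * y ≤ x * y := by gcongr; omega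
            _ = y * x := mul_comm _ _
            _ ≤ _ := by gcongr; omega
        have h4 : t k * ((k + 1) * y) ≤ t (k + 1) * ((k + 1) * y) := by
          rw [step k (by omega)]; gcongr
        exact Nat.le_of_mul_le_mul_right h4 (by positivity)
    · induction k, h using Nat.le_induction with
      | base => exact le_rfl
      | succ k hkx ih =>
        refine le_trans ?_ (ih (by omega))
        have h3 : (g - k) * x ≤ (k + 1) * y := by
          calc (g - k) * x ≤ y * x := by gcongr; omega
            _ = x * y := mul_comm _ _
            _ ≤ _ := by gcongr; omega
        have h4 : t (k + 1) * ((k + 1) * y) ≤ t k * ((k + 1) * y) := by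
          rw [step k (by omega)]; gcongr
        exact Nat.le_of_mul_le_mul_right h4 (by positivity)
  have hx : t x = (x + y).choose x * x ^ x * y ^ y := by
    simp only [ht, hg, Nat.add_sub_cancel_left]; ring
  calc (x + y) ^ g = ∑ k ∈ Finset.range (g + 1), t k := by rw [add_pow]; simp [ht]
    _ ≤ ∑ k ∈ Finset.range (g + 1), t x :=
      Finset.sum_le_sum fun k hk => key k (by simp at hk; omega)
    _ = _ := by rw [Finset.sum_const, Finset.card_range, smul_eq_mul, hx]

open Real in
theorem mul_binEntropy_le_log_choose (x y : ℕ) (hg : 0 < x + y) :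
    (x + y) * binEntropy (x / (x + y)) ≤ log ((x + y).choose x) + log (x + y + 1) := by
  have hg' : (0 : ℝ) < (x : ℝ) + y := by exact_mod_cast hg
  have hc : (0 : ℝ) < (x + y).choose x := by exact_mod_cast Nat.choose_pos (by omega)
  have e1 : (x : ℝ) / (x + y) * (x + y) = x := by field_simp
  have e2 : 1 - (x : ℝ) / (x + y) = y / (x + y) := by field_simp; ring
  have hlog : ∀ z : ℕ, (z : ℝ) / (x + y) * log (((z : ℝ) / (x + y))⁻¹) * (x + y) =
      z * log (x + y) - z * log z := by
    intro z
    rcases Nat.eq_zero_or_pos z with rfl | hz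
    · simp
    have hz' : (0 : ℝ) < z := by exact_mod_cast hz
    rw [inv_div, log_div hg'.ne' hz'.ne']
    field_simp
  have h := add_pow_le_choose_mul x y
  have hpp : ∀ z : ℕ, (0 : ℝ) < (z : ℝ) ^ z := by
    intro z
    rcases Nat.eq_zero_or_pos z with rfl | hz
    · simp
    · positivity
  have h' : ((x : ℝ) + y) ^ (x + y) ≤
      (x + y + 1) * ((x + y).choose x * (x : ℝ) ^ x * (y : ℝ) ^ y) := by exact_mod_cast h
  have := log_le_log (by positivity) h'
  rw [log_mul (by positivity) (mul_pos (mul_pos hc (hpp x)) (hpp y)).ne',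
    log_mul (mul_pos hc (hpp x)).ne' (hpp y).ne', log_mul hc.ne' (hpp x).ne', log_pow, log_pow,
    log_pow] at this
  have e3 := hlog x
  have e4 := hlog y
  unfold binEntropy
  rw [e2]
  push_cast at this
  linarith

/-! ### For every split, one of the two binomial ratios is small -/

-- Bounding the two numerators by `log_choose_le` with parameters `τ` and `1 - τ'`, and the
-- denominator from below by entropy, leaves an expression that is linear in `a` and `b` and, after
-- scaling by `x + y`, depends only on `ρ = x / (x + y)`. The hypotheses `hu` and `hv` handle the
-- coefficients of `b` and `a`. In `ρ` an affine function has to stay below the concave entropy, so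
-- checking the end points of an interval suffices.
open Real in
theorem weighted_log_ratio_le {θ τ τ' l ρ₁ ρ₂ : ℝ} (hθ0 : 0 ≤ θ) (hθ1 : θ ≤ 1) (hτ0 : 0 < τ)
    (hτ1 : τ < 1) (hτ0' : 0 < τ') (hτ1' : τ' < 1) (hu : -(θ * log (1 - τ)) ≤ l)
    (hv : -((1 - θ) * log τ') ≤ l) (h0 : 0 ≤ ρ₁) (h1 : ρ₂ ≤ 1) (h12 : ρ₁ < ρ₂)
    (hρ₁ : -(ρ₁ * (θ * log τ + (1 - θ) * log τ')) -
      (1 - ρ₁) * (θ * log (1 - τ) + (1 - θ) * log (1 - τ')) - l ≤ binEntropy ρ₁)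
    (hρ₂ : -(ρ₂ * (θ * log τ + (1 - θ) * log τ')) -
      (1 - ρ₂) * (θ * log (1 - τ) + (1 - θ) * log (1 - τ')) - l ≤ binEntropy ρ₂)
    (x y a b : ℕ) (hg : 0 < x + y) (hx1 : ρ₁ ≤ (x : ℝ) / (x + y)) (hx2 : (x : ℝ) / (x + y) ≤ ρ₂) :
    θ * (log ((x + y + b).choose x) - log ((x + y).choose x)) +
      (1 - θ) * (log ((x + y + a).choose y) - log ((x + y).choose x)) ≤
      log (x + y + 1) + l * (x + y + a + b) := by
  have hg' : (0 : ℝ) < (x : ℝ) + y := by exact_mod_cast hg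
  set ρ := (x : ℝ) / (x + y) with hρ
  set α := θ * log τ + (1 - θ) * log τ' with hα
  set β := θ * log (1 - τ) + (1 - θ) * log (1 - τ') with hβ
  -- The left side is affine in `ρ`, so the bounds at `ρ₁` and `ρ₂` interpolate by concavity.
  have chord : -(ρ * α) - (1 - ρ) * β - l ≤ binEntropy ρ := by
    set t := (ρ₂ - ρ) / (ρ₂ - ρ₁) with ht
    have hd : 0 < ρ₂ - ρ₁ := by linarith
    have ht0 : 0 ≤ t := div_nonneg (by linarith) hd.le
    have ht1 : 0 ≤ 1 - t := by
      rw [sub_nonneg, ht, div_le_one hd]; linarith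
    have hcomb : t * ρ₁ + (1 - t) * ρ₂ = ρ := by
      rw [ht]; field_simp; ring
    have hc := strictConcave_binEntropy.concaveOn.2 (x := ρ₁) (y := ρ₂) ⟨h0, by linarith⟩
      ⟨by linarith, h1⟩ ht0 ht1 (by ring)
    simp only [smul_eq_mul] at hc
    rw [hcomb] at hc
    have k1 := mul_le_mul_of_nonneg_left hρ₁ ht0
    have k2 := mul_le_mul_of_nonneg_left hρ₂ ht1
    calc -(ρ * α) - (1 - ρ) * β - l
        = t * (-(ρ₁ * α) - (1 - ρ₁) * β - l) + (1 - t) * (-(ρ₂ * α) - (1 - ρ₂) * β - l) := by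
          rw [← hcomb]; ring
      _ ≤ _ := by linarith
  have hlow := mul_binEntropy_le_log_choose x y hg
  have hmul := mul_le_mul_of_nonneg_left chord hg'.le
  have e1 : ((x : ℝ) + y) * ρ = x := by rw [hρ]; field_simp
  have e2 : ((x : ℝ) + y) * (-(ρ * α) - (1 - ρ) * β - l) = -(x * α) - y * β - l * (x + y) := by
    linear_combination (β - α) * e1
  rw [e2] at hmul
  have u := log_choose_le x (y + b) hτ0 hτ1
  have v := log_choose_le y (x + a) (τ := 1 - τ') (by linarith) (by linarith)
  rw [show x + (y + b) = x + y + b by ring] at u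
  rw [show y + (x + a) = x + y + a by ring, sub_sub_cancel] at v
  have u' := mul_le_mul_of_nonneg_left u hθ0
  have v' := mul_le_mul_of_nonneg_left v (show 0 ≤ 1 - θ by linarith)
  have hb := mul_le_mul_of_nonneg_left hu (Nat.cast_nonneg (α := ℝ) b)
  have ha := mul_le_mul_of_nonneg_left hv (Nat.cast_nonneg (α := ℝ) a)
  push_cast at u' v'
  have : θ * (-(x * log τ) - (y + b) * log (1 - τ)) +
      (1 - θ) * (-(y * log (1 - τ')) - (x + a) * log τ') =
      -(x * α) - y * β + b * -(θ * log (1 - τ)) + a * -((1 - θ) * log τ') := by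
    rw [hα, hβ]; ring
  linarith

set_option linter.unusedSimpArgs false
set_option exponentiation.threshold 2000
-- This is the critical range. The conditions on `a` and `b` and the one at `ρ = 1 / 2` all amount
-- to `4 * 271 ^ 2 ≤ 3 * 313 ^ 2`, that is, to a rate of at least `2 / √3`. In this and the next
-- three lemmas, the integer inequalities are the conditions of `weighted_log_ratio_le`,
-- exponentiated and cleared of denominators. The weight on the first ratio decreases as `ρ` grows.
open Real in
theorem weighted_log_ratio_le_half (x y a b : ℕ) (hg : 0 < x + y)
    (hx1 : 1 / 2 ≤ (x : ℝ) / (x + y)) (hx2 : (x : ℝ) / (x + y) ≤ 25 / 49) :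
    (1 / 2) * (log ((x + y + b).choose x) - log ((x + y).choose x)) +
      (1 - 1 / 2) * (log ((x + y + a).choose y) - log ((x + y).choose x)) ≤
      log (x + y + 1) + log (313 / 271) * (x + y + a + b) := by
  refine weighted_log_ratio_le (τ := 1 / 4) (τ' := 3 / 4) (ρ₁ := 1 / 2) (ρ₂ := 25 / 49)
    (by norm_num) (by norm_num) (by norm_num) (by norm_num) (by norm_num) (by norm_num)
    ?_ ?_ (by norm_num) (by norm_num) (by norm_num) ?_ ?_ x y a b hg hx1 hx2
  · have h := log_le_log (by norm_num)
      (show (4 : ℝ) * (271 : ℝ) ^ 2 ≤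
        (3 : ℝ) * (313 : ℝ) ^ 2 by norm_num)
    norm_num [binEntropy]
    simp (disch := norm_num) only [log_div, log_mul, log_pow, Nat.cast_ofNat, Nat.cast_one,
      log_one] at h ⊢
    linarith
  · have h := log_le_log (by norm_num)
      (show (4 : ℝ) * (271 : ℝ) ^ 2 ≤
        (3 : ℝ) * (313 : ℝ) ^ 2 by norm_num)
    norm_num [binEntropy]
    simp (disch := norm_num) only [log_div, log_mul, log_pow, Nat.cast_ofNat, Nat.cast_one,
      log_one] at h ⊢
    linarith
  · have h := log_le_log (by norm_num)
      (show (4 : ℝ) ^ 2 * (271 : ℝ) ^ 2 ≤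
        (3 : ℝ) * (313 : ℝ) ^ 2 * (2 : ℝ) ^ 2 by norm_num)
    norm_num [binEntropy]
    simp (disch := norm_num) only [log_div, log_mul, log_pow, Nat.cast_ofNat, Nat.cast_one,
      log_one] at h ⊢
    linarith
  · have h := log_le_log (by norm_num)
      (show (4 : ℝ) ^ 98 * (271 : ℝ) ^ 98 * (25 : ℝ) ^ 50 * (24 : ℝ) ^ 48 ≤
        (3 : ℝ) ^ 49 * (313 : ℝ) ^ 98 * (49 : ℝ) ^ 98 by norm_num)
    norm_num [binEntropy]
    simp (disch := norm_num) only [log_div, log_mul, log_pow, Nat.cast_ofNat, Nat.cast_one,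
      log_one] at h ⊢
    linarith

open Real in
theorem weighted_log_ratio_le_five_elevenths (x y a b : ℕ) (hg : 0 < x + y)
    (hx1 : 25 / 49 ≤ (x : ℝ) / (x + y)) (hx2 : (x : ℝ) / (x + y) ≤ 7 / 12) :
    (5 / 11) * (log ((x + y + b).choose x) - log ((x + y).choose x)) +
      (1 - 5 / 11) * (log ((x + y + a).choose y) - log ((x + y).choose x)) ≤
      log (x + y + 1) + log (313 / 271) * (x + y + a + b) := by
  refine weighted_log_ratio_le (τ := 16 / 59) (τ' := 43 / 56) (ρ₁ := 25 / 49) (ρ₂ := 7 / 12)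
    (by norm_num) (by norm_num) (by norm_num) (by norm_num) (by norm_num) (by norm_num)
    ?_ ?_ (by norm_num) (by norm_num) (by norm_num) ?_ ?_ x y a b hg hx1 hx2
  · have h := log_le_log (by norm_num)
      (show (59 : ℝ) ^ 5 * (271 : ℝ) ^ 11 ≤
        (43 : ℝ) ^ 5 * (313 : ℝ) ^ 11 by norm_num)
    norm_num [binEntropy]
    simp (disch := norm_num) only [log_div, log_mul, log_pow, Nat.cast_ofNat, Nat.cast_one,
      log_one] at h ⊢
    linarith
  · have h := log_le_log (by norm_num)
      (show (56 : ℝ) ^ 6 * (271 : ℝ) ^ 11 ≤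
        (43 : ℝ) ^ 6 * (313 : ℝ) ^ 11 by norm_num)
    norm_num [binEntropy]
    simp (disch := norm_num) only [log_div, log_mul, log_pow, Nat.cast_ofNat, Nat.cast_one,
      log_one] at h ⊢
    linarith
  · have h := log_le_log (by norm_num)
      (show (59 : ℝ) ^ 245 * (56 : ℝ) ^ 294 * (271 : ℝ) ^ 539 * (25 : ℝ) ^ 275 * (24 : ℝ) ^ 264 ≤
        (16 : ℝ) ^ 125 * (43 : ℝ) ^ 270 * (13 : ℝ) ^ 144 * (313 : ℝ) ^ 539 * (49 : ℝ) ^ 539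
        by norm_num)
    norm_num [binEntropy]
    simp (disch := norm_num) only [log_div, log_mul, log_pow, Nat.cast_ofNat, Nat.cast_one,
      log_one] at h ⊢
    linarith
  · have h := log_le_log (by norm_num)
      (show (59 : ℝ) ^ 60 * (56 : ℝ) ^ 72 * (271 : ℝ) ^ 132 * (7 : ℝ) ^ 77 * (5 : ℝ) ^ 55 ≤
        (16 : ℝ) ^ 35 * (43 : ℝ) ^ 67 * (13 : ℝ) ^ 30 * (313 : ℝ) ^ 132 * (12 : ℝ) ^ 132
        by norm_num)
    norm_num [binEntropy]
    simp (disch := norm_num) only [log_div, log_mul, log_pow, Nat.cast_ofNat, Nat.cast_one,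
      log_one] at h ⊢
    linarith

open Real in
theorem weighted_log_ratio_le_third (x y a b : ℕ) (hg : 0 < x + y)
    (hx1 : 7 / 12 ≤ (x : ℝ) / (x + y)) (hx2 : (x : ℝ) / (x + y) ≤ 2 / 3) :
    (1 / 3) * (log ((x + y + b).choose x) - log ((x + y).choose x)) +
      (1 - 1 / 3) * (log ((x + y + a).choose y) - log ((x + y).choose x)) ≤
      log (x + y + 1) + log (313 / 271) * (x + y + a + b) := by
  refine weighted_log_ratio_le (τ := 1 / 3) (τ' := 9 / 11) (ρ₁ := 7 / 12) (ρ₂ := 2 / 3)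
    (by norm_num) (by norm_num) (by norm_num) (by norm_num) (by norm_num) (by norm_num)
    ?_ ?_ (by norm_num) (by norm_num) (by norm_num) ?_ ?_ x y a b hg hx1 hx2
  · have h := log_le_log (by norm_num)
      (show (3 : ℝ) * (271 : ℝ) ^ 3 ≤
        (2 : ℝ) * (313 : ℝ) ^ 3 by norm_num)
    norm_num [binEntropy]
    simp (disch := norm_num) only [log_div, log_mul, log_pow, Nat.cast_ofNat, Nat.cast_one,
      log_one] at h ⊢
    linarith
  · have h := log_le_log (by norm_num)
      (show (11 : ℝ) ^ 2 * (271 : ℝ) ^ 3 ≤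
        (9 : ℝ) ^ 2 * (313 : ℝ) ^ 3 by norm_num)
    norm_num [binEntropy]
    simp (disch := norm_num) only [log_div, log_mul, log_pow, Nat.cast_ofNat, Nat.cast_one,
      log_one] at h ⊢
    linarith
  · have h := log_le_log (by norm_num)
      (show (3 : ℝ) ^ 12 * (11 : ℝ) ^ 24 * (271 : ℝ) ^ 36 * (7 : ℝ) ^ 21 * (5 : ℝ) ^ 15 ≤
        (9 : ℝ) ^ 14 * (2 : ℝ) ^ 15 * (313 : ℝ) ^ 36 * (12 : ℝ) ^ 36 by norm_num)
    norm_num [binEntropy]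
    simp (disch := norm_num) only [log_div, log_mul, log_pow, Nat.cast_ofNat, Nat.cast_one,
      log_one] at h ⊢
    linarith
  · have h := log_le_log (by norm_num)
      (show (11 : ℝ) ^ 6 * (2 : ℝ) ^ 3 * (271 : ℝ) ^ 9 ≤
        (3 : ℝ) ^ 6 * (9 : ℝ) ^ 4 * (313 : ℝ) ^ 9 by norm_num)
    norm_num [binEntropy]
    simp (disch := norm_num) only [log_div, log_mul, log_pow, Nat.cast_ofNat, Nat.cast_one,
      log_one] at h ⊢
    linarith

open Real in
theorem weighted_log_ratio_le_zero (x y a b : ℕ) (hg : 0 < x + y)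
    (hx1 : 2 / 3 ≤ (x : ℝ) / (x + y)) (hx2 : (x : ℝ) / (x + y) ≤ 1) :
    (0) * (log ((x + y + b).choose x) - log ((x + y).choose x)) +
      (1 - 0) * (log ((x + y + a).choose y) - log ((x + y).choose x)) ≤
      log (x + y + 1) + log (313 / 271) * (x + y + a + b) := by
  refine weighted_log_ratio_le (τ := 1 / 2) (τ' := 13 / 15) (ρ₁ := 2 / 3) (ρ₂ := 1)
    (by norm_num) (by norm_num) (by norm_num) (by norm_num) (by norm_num) (by norm_num)
    ?_ ?_ (by norm_num) (by norm_num) (by norm_num) ?_ ?_ x y a b hg hx1 hx2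
  · have h := log_le_log (by norm_num)
      (show (271 : ℝ) ≤
        (313 : ℝ) by norm_num)
    norm_num [binEntropy]
    simp (disch := norm_num) only [log_div, log_mul, log_pow, Nat.cast_ofNat, Nat.cast_one,
      log_one] at h ⊢
    linarith
  · have h := log_le_log (by norm_num)
      (show (15 : ℝ) * (271 : ℝ) ≤
        (13 : ℝ) * (313 : ℝ) by norm_num)
    norm_num [binEntropy]
    simp (disch := norm_num) only [log_div, log_mul, log_pow, Nat.cast_ofNat, Nat.cast_one,
      log_one] at h ⊢
    linarith
  · have h := log_le_log (by norm_num)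
      (show (15 : ℝ) ^ 3 * (2 : ℝ) * (271 : ℝ) ^ 3 ≤
        (13 : ℝ) ^ 2 * (313 : ℝ) ^ 3 * (3 : ℝ) ^ 3 by norm_num)
    norm_num [binEntropy]
    simp (disch := norm_num) only [log_div, log_mul, log_pow, Nat.cast_ofNat, Nat.cast_one,
      log_one] at h ⊢
    linarith
  · have h := log_le_log (by norm_num)
      (show (15 : ℝ) * (271 : ℝ) ≤
        (13 : ℝ) * (313 : ℝ) by norm_num)
    norm_num [binEntropy]
    simp (disch := norm_num) only [log_div, log_mul, log_pow, Nat.cast_ofNat, Nat.cast_one,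
      log_one] at h ⊢
    linarith


open Real in
theorem le_or_le_of_weighted {θ A B R : ℝ} (h0 : 0 ≤ θ) (h1 : θ ≤ 1)
    (h : θ * A + (1 - θ) * B ≤ R) : A ≤ R ∨ B ≤ R := by
  by_contra! hc
  rcases h0.eq_or_lt with rfl | h0
  · linarith [hc.2]
  · have := mul_lt_mul_of_pos_left hc.1 h0
    have := mul_le_mul_of_nonneg_left hc.2.le (show 0 ≤ 1 - θ by linarith)
    linarith

/-- The growth rate, slightly above `2 / √3` and below `1.155`. -/
noncomputable def coverRate : ℝ := 313 / 271

open Real in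
theorem log_ratio_le_or_of_le (x y a b : ℕ) (hg : 0 < x + y) (hxy : y ≤ x) :
    log ((x + y + b).choose x) - log ((x + y).choose x) ≤
        log (x + y + 1) + log coverRate * (x + y + a + b) ∨
      log ((x + y + a).choose y) - log ((x + y).choose x) ≤
        log (x + y + 1) + log coverRate * (x + y + a + b) := by
  have hg' : (0 : ℝ) < (x : ℝ) + y := by exact_mod_cast hg
  have hxy' : (y : ℝ) ≤ x := by exact_mod_cast hxy
  have h0 : 1 / 2 ≤ (x : ℝ) / (x + y) := by rw [le_div_iff₀ hg']; linarith
  have h1 : (x : ℝ) / (x + y) ≤ 1 := by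
    rw [div_le_one hg']; linarith [Nat.cast_nonneg (α := ℝ) y]
  unfold coverRate
  rcases le_total ((x : ℝ) / (x + y)) (25 / 49) with h | h
  · exact le_or_le_of_weighted (by norm_num) (by norm_num)
      (weighted_log_ratio_le_half x y a b hg h0 h)
  rcases le_total ((x : ℝ) / (x + y)) (7 / 12) with h' | h'
  · exact le_or_le_of_weighted (by norm_num) (by norm_num)
      (weighted_log_ratio_le_five_elevenths x y a b hg h h')
  rcases le_total ((x : ℝ) / (x + y)) (2 / 3) with h'' | h''
  · exact le_or_le_of_weighted (by norm_num) (by norm_num)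
      (weighted_log_ratio_le_third x y a b hg h' h'')
  · exact le_or_le_of_weighted (by norm_num) (by norm_num)
      (weighted_log_ratio_le_zero x y a b hg h'' h1)

/-- Four intervals cover `1 / 2 ≤ x / (x + y) ≤ 1`; the case `x ≤ y` follows by exchanging `x` with
`y` and `a` with `b`, which exchanges the two alternatives. -/
theorem choose_le_or_choose_le (x y a b : ℕ) :
    ((x + y + b).choose x : ℝ) ≤
        (x + y + 1) * coverRate ^ (x + y + a + b) * (x + y).choose x ∨
      ((x + y + a).choose y : ℝ) ≤
        (x + y + 1) * coverRate ^ (x + y + a + b) * (x + y).choose x := by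
  have hr : (1 : ℝ) ≤ coverRate := by norm_num [coverRate]
  rcases Nat.eq_zero_or_pos (x + y) with h | hg
  · obtain ⟨rfl, rfl⟩ : x = 0 ∧ y = 0 := by omega
    left
    simpa using one_le_pow₀ hr
  have pos : ∀ n k : ℕ, k ≤ n → (0 : ℝ) < n.choose k := fun n k h => by
    exact_mod_cast Nat.choose_pos h
  have c := pos (x + y) x (by omega)
  have key : ∀ N : ℝ, 0 < N → Real.log N - Real.log ((x + y).choose x) ≤
      Real.log (x + y + 1) + Real.log coverRate * (x + y + a + b) →
      N ≤ (x + y + 1) * coverRate ^ (x + y + a + b) * (x + y).choose x := by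
    intro N hN h
    rw [← Real.log_le_log_iff hN (by positivity), Real.log_mul (by positivity) c.ne',
      Real.log_mul (by positivity) (by positivity), Real.log_pow]
    push_cast
    linarith
  rcases le_total y x with h | h
  · exact (log_ratio_le_or_of_le x y a b hg h).imp (key _ (pos _ _ (by omega)))
      (key _ (pos _ _ (by omega)))
  · have := log_ratio_le_or_of_le y x b a (by omega) h
    rw [add_comm y x, show (x + y).choose y = (x + y).choose x by
      rw [Nat.choose_symm_add], add_comm (y : ℝ) x, add_right_comm _ (b : ℝ)] at this
    exact this.symm.imp (key _ (pos _ _ (by omega))) (key _ (pos _ _ (by omega)))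

/-- Take the least `x` for which the second bound holds; `x = g` qualifies because `C(g + a, 0) =
1`. The second bound fails at `x - 1`, so the first one holds there, and one step changes the first
ratio by at most the factor `g + a + b + 1`, whence the square. If `x = 0`, the first bound is
trivial. -/
theorem exists_balanced_choose (a b g : ℕ) : ∃ x y : ℕ, x + y = g ∧
    ((g + b).choose x : ℝ) ≤
      (g + a + b + 1) ^ 2 * coverRate ^ (g + a + b) * g.choose x ∧
    ((g + a).choose y : ℝ) ≤
      (g + a + b + 1) ^ 2 * coverRate ^ (g + a + b) * g.choose x := by
  have hr : (1 : ℝ) ≤ coverRate ^ (g + a + b) := one_le_pow₀ (by norm_num [coverRate])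
  set R := coverRate ^ (g + a + b) with hR
  have hs : (1 : ℝ) ≤ (g : ℝ) + a + b + 1 := by
    have : (0 : ℝ) ≤ (g : ℝ) + a + b := by positivity
    linarith
  have hsg : (g : ℝ) + 1 ≤ (g : ℝ) + a + b + 1 := by
    have : (0 : ℝ) ≤ (a : ℝ) + b := by positivity
    linarith
  have hs2 : ((g : ℝ) + 1) * R ≤ (g + a + b + 1) ^ 2 * R := by
    rw [sq]
    have : (g : ℝ) + 1 ≤ (g + a + b + 1) * (g + a + b + 1) := by
      nlinarith [mul_le_mul_of_nonneg_left hs (show (0 : ℝ) ≤ g + a + b + 1 by linarith)]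
    gcongr
  let P : ℕ → Prop := fun x => x ≤ g ∧ ((g + a).choose (g - x) : ℝ) ≤ (g + 1) * R * g.choose x
  have hP : ∃ x, P x := by
    refine ⟨g, le_rfl, ?_⟩
    have : (0 : ℝ) ≤ g := by positivity
    simp only [Nat.sub_self, Nat.choose_zero_right, Nat.choose_self, Nat.cast_one, mul_one]
    nlinarith
  classical
  obtain ⟨hx, hv⟩ := Nat.find_spec hP
  set x := Nat.find hP with hxdef
  refine ⟨x, g - x, by omega, ?_, hv.trans (by gcongr)⟩
  rcases Nat.eq_zero_or_pos x with h0 | hpos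
  · rw [h0]
    simp only [Nat.choose_zero_right, Nat.cast_one, mul_one]
    nlinarith
  obtain ⟨k, hk⟩ : ∃ k, x = k + 1 := ⟨x - 1, by omega⟩
  have hnot : ¬ P k := Nat.find_min hP (by omega)
  have hu : ((g + b).choose k : ℝ) ≤ (g + 1) * R * g.choose k := by
    have := choose_le_or_choose_le k (g - k) a b
    rw [show k + (g - k) = g by omega, ← hR, show ((k : ℝ) + (g - k : ℕ) : ℝ) = g by
      rw [← Nat.cast_add]; congr 1; omega] at this
    exact this.resolve_right fun h => hnot ⟨by omega, h⟩
  have e1 : ((g + b).choose x : ℝ) * (k + 1) = (g + b).choose k * (g + b - k : ℕ) := by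
    rw [hk]; exact_mod_cast Nat.choose_succ_right_eq (g + b) k
  have e2 : (g.choose x : ℝ) * (k + 1) = g.choose k * (g - k : ℕ) := by
    rw [hk]; exact_mod_cast Nat.choose_succ_right_eq g k
  have e3 : ((g + b - k : ℕ) : ℝ) ≤ (g + a + b + 1) * (g - k : ℕ) := by
    have h : g + b - k ≤ (g + a + b + 1) * (g - k) := by
      have : 1 ≤ g - k := by omega
      calc g + b - k ≤ (g + a + b + 1) * 1 := by omega
        _ ≤ _ := by gcongr
    exact_mod_cast h
  refine le_of_mul_le_mul_right ?_ (show (0 : ℝ) < k + 1 by positivity)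
  calc ((g + b).choose x : ℝ) * (k + 1) = (g + b).choose k * (g + b - k : ℕ) := e1
    _ ≤ ((g + 1) * R * g.choose k) * ((g + a + b + 1) * (g - k : ℕ)) := by gcongr
    _ ≤ ((g + a + b + 1) * R * g.choose k) * ((g + a + b + 1) * (g - k : ℕ)) := by gcongr
    _ = (g + a + b + 1) ^ 2 * R * (g.choose k * (g - k : ℕ)) := by ring
    _ = _ := by rw [← e2]; ring

/-! ### Separating families by sampling -/

/-- The right side bounds the expected potential of `N` independent samples: each sample multiplies
the expected indicator that `i` is still missed by at most `1 - p`, and the expectation of `2 ^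
count` by at most `1 + q`. The samples are fixed one at a time by averaging, which needs no
probability space. -/
theorem exists_list_potential_le {Ω I J : Type*} [Fintype I] [Fintype J] (S : Finset Ω)
    (hS : S.Nonempty) (G : I → Ω → Prop) (H : J → Ω → Prop)
    [∀ i, DecidablePred (G i)] [∀ j, DecidablePred (H j)] {p q : ℝ} (hp : p ≤ 1) (hq : 0 ≤ q)
    (hG : ∀ i, p * S.card ≤ (S.filter (G i)).card) (hH : ∀ j, (S.filter (H j)).card ≤ q * S.card)
    (N : ℕ) (α β : ℝ) (hα : 0 ≤ α) (hβ : 0 ≤ β) :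
    ∃ L : List Ω, (∀ W ∈ L, W ∈ S) ∧
      α * (∑ i : I, if ∀ W ∈ L, ¬ G i W then (1 : ℝ) else 0) +
        β * ∑ j : J, (2 : ℝ) ^ L.countP (H j ·) ≤
      α * Fintype.card I * (1 - p) ^ N + β * Fintype.card J * (1 + q) ^ N := by
  induction N generalizing α β with
  | zero => exact ⟨[], by simp, by simp⟩
  | succ N ih =>
    -- The list `L` is picked for weights that already account for the expected effect of one
    -- further sample.
    obtain ⟨L, hLS, hL⟩ := ih (α * (1 - p)) (β * (1 + q)) (by nlinarith) (by positivity)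
    suffices h : ∃ W ∈ S,
        α * (∑ i : I, if ∀ W' ∈ W :: L, ¬ G i W' then (1 : ℝ) else 0) +
          β * ∑ j : J, (2 : ℝ) ^ (W :: L).countP (H j ·) ≤
        α * (1 - p) * (∑ i : I, if ∀ W ∈ L, ¬ G i W then (1 : ℝ) else 0) +
          β * (1 + q) * ∑ j : J, (2 : ℝ) ^ L.countP (H j ·) by
      obtain ⟨W, hW, h⟩ := h
      refine ⟨W :: L, ?_, h.trans (hL.trans_eq ?_)⟩
      · simpa [hW] using hLS
      · ring
    apply Finset.exists_le_of_sum_le hS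
    rw [Finset.sum_const, nsmul_eq_mul, Finset.sum_add_distrib, ← Finset.mul_sum, ← Finset.mul_sum,
      Finset.sum_comm, Finset.sum_comm (s := S) (t := Finset.univ)]
    have h1 : ∀ i : I, (∑ W ∈ S, if ∀ W' ∈ W :: L, ¬ G i W' then (1 : ℝ) else 0) ≤
        S.card * (1 - p) * if ∀ W ∈ L, ¬ G i W then (1 : ℝ) else 0 := by
      intro i
      by_cases h : ∀ W ∈ L, ¬ G i W
      · rw [if_pos h, mul_one]
        have e : ∀ W, (∀ W' ∈ W :: L, ¬ G i W') ↔ ¬ G i W := by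
          intro W; simpa using fun _ => h
        simp only [e, Finset.sum_boole]
        have := Finset.card_filter_add_card_filter_not (s := S) (G i)
        have h2 : ((S.filter (G i)).card : ℝ) + (S.filter fun W => ¬ G i W).card = S.card := by
          exact_mod_cast this
        linarith [hG i]
      · rw [if_neg h, mul_zero]
        refine (Finset.sum_eq_zero fun W _ => if_neg fun hW => h ?_).le
        intro W' hW'
        exact hW W' (List.mem_cons_of_mem _ hW')
    have h2 : ∀ j : J, (∑ W ∈ S, (2 : ℝ) ^ (W :: L).countP (H j ·)) ≤
        S.card * (1 + q) * (2 : ℝ) ^ L.countP (H j ·) := by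
      intro j
      have e : ∀ W, (2 : ℝ) ^ (W :: L).countP (H j ·) =
          (1 + if H j W then 1 else 0) * (2 : ℝ) ^ L.countP (H j ·) := by
        intro W
        rw [List.countP_cons]
        by_cases h : H j W
        · simp [h, pow_succ]; ring
        · simp [h]
      simp only [e]
      rw [← Finset.sum_mul, Finset.sum_add_distrib, Finset.sum_boole, Finset.sum_const, nsmul_eq_mul]
      gcongr
      linarith [hH j]
    have k1 := mul_le_mul_of_nonneg_left (Finset.sum_le_sum fun i (_ : i ∈ Finset.univ) => h1 i) hα
    have k2 := mul_le_mul_of_nonneg_left (Finset.sum_le_sum fun j (_ : j ∈ Finset.univ) => h2 j) hβ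
    rw [← Finset.mul_sum] at k1 k2
    linarith

/-- About `log |I| / p` samples hit every `G i`, and a set `H j` of density at most `r * p` is then
met about `r * log |I|` times. The exponential moment controls all `j` at once, at the additive
price `log |J|`. -/
theorem exists_hitting_finset {Ω I J : Type*} [Fintype I] [Fintype J] [Nonempty J] (S : Finset Ω)
    (hS : S.Nonempty) (G : I → Ω → Prop) (H : J → Ω → Prop)
    [∀ i, DecidablePred (G i)] [∀ j, DecidablePred (H j)] {p r : ℝ} (hp0 : 0 < p) (hp : p ≤ 1)
    (hr : 0 ≤ r) (hG : ∀ i, p * S.card ≤ (S.filter (G i)).card)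
    (hH : ∀ j, (S.filter (H j)).card ≤ r * p * S.card) :
    ∃ F : Finset Ω, (∀ i, ∃ W ∈ F, G i W) ∧ ∀ j, ((F.filter (H j)).card : ℝ) ≤
      2 * (Real.log (2 * Fintype.card J) + r * (Real.log (2 * Fintype.card I + 1) + 1)) := by
  classical
  set N := ⌈Real.log (2 * Fintype.card I + 1) / p⌉₊ with hN
  set X : ℝ := Fintype.card J * (1 + r * p) ^ N with hX
  have hJ : (0 : ℝ) < Fintype.card J := by exact_mod_cast Fintype.card_pos
  have hrp : 0 ≤ r * p := by positivity
  have hXpos : 0 < X := by positivity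
  -- With weight `2 * X` a single missed `i` would cost the whole budget: `N` is so large that the
  -- potential stays below `2 * X`. Hence nothing is missed, and each `2 ^ count` is at most `2 *
  -- X`.
  obtain ⟨L, -, hL⟩ := exists_list_potential_le S hS G H hp hrp hG hH N (2 * X) 1
    (by positivity) zero_le_one
  rw [one_mul, one_mul, ← hX] at hL
  have hI : (0 : ℝ) ≤ Fintype.card I := by positivity
  have hlog : 0 ≤ Real.log (2 * Fintype.card I + 1) := Real.log_nonneg (by linarith)
  have hNp : Real.log (2 * Fintype.card I + 1) ≤ p * N := by
    have := Nat.le_ceil (Real.log (2 * Fintype.card I + 1) / p)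
    rw [div_le_iff₀ hp0] at this
    linarith
  have hsmall : 2 * Fintype.card I * (1 - p) ^ N < 1 := by
    have h1 : (1 - p) ^ N ≤ Real.exp (-Real.log (2 * Fintype.card I + 1)) := by
      calc (1 - p) ^ N ≤ Real.exp (-p) ^ N := by
            gcongr
            linarith [Real.add_one_le_exp (-p)]
        _ = Real.exp (-(p * N)) := by rw [← Real.exp_nat_mul]; ring_nf
        _ ≤ _ := Real.exp_le_exp.2 (by linarith)
    rw [Real.exp_neg, Real.exp_log (by linarith)] at h1
    calc 2 * Fintype.card I * (1 - p) ^ N ≤ 2 * Fintype.card I * (2 * Fintype.card I + 1 : ℝ)⁻¹ := by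
          gcongr
      _ < 1 := by rw [← div_eq_mul_inv, div_lt_one (by linarith)]; linarith
  have htot : 2 * X * Fintype.card I * (1 - p) ^ N + X < 2 * X := by nlinarith
  have hnn1 : 0 ≤ ∑ i : I, if ∀ W ∈ L, ¬ G i W then (1 : ℝ) else 0 :=
    Finset.sum_nonneg fun _ _ => by split_ifs <;> norm_num
  have hnn2 : 0 ≤ ∑ j : J, (2 : ℝ) ^ L.countP (H j ·) := by positivity
  refine ⟨L.toFinset, ?_, ?_⟩
  · intro i
    by_contra! hc
    have h1 : (1 : ℝ) ≤ ∑ i : I, if ∀ W ∈ L, ¬ G i W then (1 : ℝ) else 0 := by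
      have := Finset.single_le_sum (s := Finset.univ)
        (f := fun i : I => if ∀ W ∈ L, ¬ G i W then (1 : ℝ) else 0)
        (fun _ _ => by split_ifs <;> norm_num) (Finset.mem_univ i)
      refine le_trans ?_ this
      rw [if_pos]
      intro W hW
      exact hc W (by simpa using hW)
    nlinarith
  · intro j
    have h1 : (2 : ℝ) ^ L.countP (H j ·) ≤ 2 * X := by
      have := Finset.single_le_sum (s := Finset.univ)
        (f := fun j : J => (2 : ℝ) ^ L.countP (H j ·)) (fun _ _ => by positivity)
        (Finset.mem_univ j)
      nlinarith
    have h2 : (L.toFinset.filter (H j)).card ≤ L.countP (H j ·) := by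
      rw [List.countP_eq_length_filter]
      refine (Finset.card_le_card (t := (L.filter (H j ·)).toFinset) ?_).trans
        (List.toFinset_card_le _)
      intro W hW
      simpa using hW
    have h2' : ((L.toFinset.filter (H j)).card : ℝ) ≤ (L.countP (H j ·) : ℝ) := by exact_mod_cast h2
    have h3 := Real.log_le_log (by positivity) h1
    rw [hX, ← mul_assoc, Real.log_pow, Real.log_mul (by positivity) (by positivity),
      Real.log_pow] at h3
    have h4 : Real.log (1 + r * p) ≤ r * p := by
      have := Real.log_le_sub_one_of_pos (show 0 < 1 + r * p by positivity)
      linarith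
    have h5 : (N : ℝ) * Real.log (1 + r * p) ≤ r * (Real.log (2 * Fintype.card I + 1) + 1) := by
      have hN' : (N : ℝ) ≤ Real.log (2 * Fintype.card I + 1) / p + 1 :=
        (Nat.ceil_lt_add_one (by positivity)).le
      calc (N : ℝ) * Real.log (1 + r * p) ≤ N * (r * p) := by gcongr
        _ ≤ (Real.log (2 * Fintype.card I + 1) / p + 1) * (r * p) := by gcongr
        _ = r * (Real.log (2 * Fintype.card I + 1) + p) := by field_simp
        _ ≤ _ := by gcongr
    have h6 : (1 : ℝ) / 2 ≤ Real.log 2 := by linarith [Real.log_two_gt_d9]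
    have h7 : (L.countP (H j ·) : ℝ) * (1 / 2) ≤ L.countP (H j ·) * Real.log 2 := by gcongr
    linarith

/-- Such a `W` is `u` together with `x` elements outside `u ∪ v`. Taking `v = ∅` or `u = ∅` gives
the counts for the one-sided events. -/
theorem card_filter_powersetCard {s : ℕ} (u v : Finset (Fin s)) (h : Disjoint u v) (x : ℕ) :
    ((Finset.univ.powersetCard (u.card + x)).filter fun W => u ⊆ W ∧ Disjoint W v).card =
      (s - u.card - v.card).choose x := by
  have hc : (u ∪ v)ᶜ.card = s - u.card - v.card := by
    rw [Finset.card_compl, Fintype.card_fin, Finset.card_union_of_disjoint h, Nat.sub_sub]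
  rw [← hc, ← Finset.card_powersetCard]
  symm
  have hdisj : ∀ Y ∈ (u ∪ v)ᶜ.powersetCard x, Disjoint u Y ∧ Disjoint Y v := by
    intro Y hY
    have := Finset.subset_compl_iff_disjoint_right.1 (Finset.mem_powersetCard.1 hY).1
    rw [Finset.disjoint_union_right] at this
    exact ⟨this.1.symm, this.2⟩
  refine Finset.card_bij' (fun Y _ => u ∪ Y) (fun W _ => W \ u) ?_ ?_ ?_ ?_
  · intro Y hY
    simp only [Finset.mem_filter, Finset.mem_powersetCard, Finset.subset_univ, true_and]
    refine ⟨?_, Finset.subset_union_left, ?_⟩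
    · rw [Finset.card_union_of_disjoint (hdisj Y hY).1, (Finset.mem_powersetCard.1 hY).2]
    · exact Finset.disjoint_union_left.2 ⟨h, (hdisj Y hY).2⟩
  · intro W hW
    simp only [Finset.mem_filter, Finset.mem_powersetCard, Finset.subset_univ, true_and] at hW
    rw [Finset.mem_powersetCard, Finset.card_sdiff_of_subset hW.2.1, hW.1,
      Finset.subset_compl_iff_disjoint_right, Finset.disjoint_union_right]
    exact ⟨⟨Finset.sdiff_disjoint, hW.2.2.mono_left Finset.sdiff_subset⟩, by omega⟩
  · intro Y hY
    exact Finset.union_sdiff_cancel_left (hdisj Y hY).1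
  · intro W hW
    simp only [Finset.mem_filter] at hW
    exact Finset.union_sdiff_of_subset hW.2.1

theorem exists_separating_family (s a b : ℕ) (hab : a + b ≤ s) :
    ∃ F : Finset (Finset (Fin s)),
      (∀ u v : Finset (Fin s), u.card = a → v.card = b → Disjoint u v →
        ∃ W ∈ F, u ⊆ W ∧ Disjoint W v) ∧
      (∀ u : Finset (Fin s), u.card = a →
        ((F.filter (u ⊆ ·)).card : ℝ) ≤ 10 * (s + 1) ^ 3 * coverRate ^ s) ∧
      (∀ v : Finset (Fin s), v.card = b →
        ((F.filter (Disjoint · v)).card : ℝ) ≤ 10 * (s + 1) ^ 3 * coverRate ^ s) := by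
  classical
  obtain ⟨x, y, hxy, hu, hv⟩ := exists_balanced_choose a b (s - a - b)
  have hR : (1 : ℝ) ≤ coverRate ^ s := one_le_pow₀ (by norm_num [coverRate])
  have hs : s - a - b + a + b = s := by omega
  have hs' : ((s - a - b : ℕ) : ℝ) + a + b = s := by exact_mod_cast congrArg (Nat.cast (R := ℝ)) hs
  rw [hs, hs'] at hu hv
  set r : ℝ := (s + 1) ^ 2 * coverRate ^ s with hr
  set Ω : Finset (Finset (Fin s)) := Finset.univ.powersetCard (a + x) with hΩ
  have hcard : Ω.card = s.choose (a + x) := by simp [hΩ]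
  have hpos : (0 : ℝ) < s.choose (a + x) := by exact_mod_cast Nat.choose_pos (by omega)
  have hpos' : (0 : ℝ) < (s - a - b).choose x := by exact_mod_cast Nat.choose_pos (by omega)
  set p : ℝ := (s - a - b).choose x / s.choose (a + x) with hp
  have hpS : p * Ω.card = (s - a - b).choose x := by rw [hcard, hp]; field_simp
  let I := {uv : Finset (Fin s) × Finset (Fin s) //
    uv.1.card = a ∧ uv.2.card = b ∧ Disjoint uv.1 uv.2}
  let J := Bool × Finset (Fin s)
  -- `G` is indexed by the pairs to be separated; `H` collects the one-sided events of both sides,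
  -- the Boolean telling which side is meant. `H` is false for sets of the wrong size.
  let G : I → Finset (Fin s) → Prop := fun i W => i.1.1 ⊆ W ∧ Disjoint W i.1.2
  let H : J → Finset (Fin s) → Prop := fun j W =>
    if j.1 then j.2.card = a ∧ j.2 ⊆ W else j.2.card = b ∧ Disjoint W j.2
  have hGcard : ∀ i, (Ω.filter (G i)).card = (s - a - b).choose x := by
    rintro ⟨⟨u, v⟩, rfl, rfl, h⟩
    exact card_filter_powersetCard u v h x
  have hUcard : ∀ u : Finset (Fin s), u.card = a →
      (Ω.filter (u ⊆ ·)).card = (s - a - b + b).choose x := by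
    rintro u rfl
    have := card_filter_powersetCard u ∅ (Finset.disjoint_empty_right u) x
    rw [show s - u.card - b + b = s - u.card by omega]
    simpa using this
  have hVcard : ∀ v : Finset (Fin s), v.card = b →
      (Ω.filter (Disjoint · v)).card = (s - a - b + a).choose y := by
    rintro v rfl
    have := card_filter_powersetCard ∅ v (Finset.disjoint_empty_left v) (a + x)
    rw [← Nat.choose_symm (by omega), show s - a - v.card + a - y = a + x by omega,
      show s - a - v.card + a = s - v.card by omega]
    simpa using this
  have hΩne : Ω.Nonempty := by
    rw [← Finset.card_pos, hcard]; exact Nat.choose_pos (by omega)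
  have hp0 : 0 < p := by positivity
  have hp1 : p ≤ 1 := by
    rw [hp, div_le_one hpos]
    have h1 : (s - a - b).choose x ≤ s.choose (a + x) := by
      obtain ⟨u, hu⟩ : ∃ u : Finset (Fin s), u.card = a :=
        (Finset.exists_subset_card_eq (s := Finset.univ) (n := a) (by simp; omega)).imp
          fun _ h => h.2
      obtain ⟨v, hvu, hv⟩ := Finset.exists_subset_card_eq (s := uᶜ) (n := b)
        (by rw [Finset.card_compl, hu, Fintype.card_fin]; omega)
      rw [← hGcard ⟨(u, v), hu, hv,
        (Finset.subset_compl_iff_disjoint_right.1 hvu).symm⟩, ← hcard]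
      exact Finset.card_filter_le _ _
    exact_mod_cast h1
  have hr1 : 1 ≤ r := by
    rw [hr]
    have : (1 : ℝ) ≤ (s + 1) ^ 2 := one_le_pow₀ (by linarith [Nat.cast_nonneg (α := ℝ) s])
    nlinarith
  have key : ∀ j, (Ω.filter (H j)).card ≤ r * p * Ω.card := by
    rintro ⟨c, u⟩
    rw [mul_assoc, hpS]
    have zero : (0 : ℝ) ≤ r * (s - a - b).choose x := by positivity
    cases c with
    | true =>
      by_cases h : u.card = a
      · simpa [H, h, hUcard u h] using hu
      · simpa [H, h] using zero
    | false =>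
      by_cases h : u.card = b
      · simpa [H, h, hVcard u h] using hv
      · simpa [H, h] using zero
  obtain ⟨F, hF1, hF2⟩ := exists_hitting_finset Ω hΩne G H (r := r) hp0 hp1 (by linarith)
    (fun i => by rw [hpS]; rw [hGcard i]) key
  have hlog2 : Real.log 2 ≤ 1 := by linarith [Real.log_two_lt_d9]
  have hlog2' : 0 ≤ Real.log 2 := Real.log_nonneg (by norm_num)
  have hs0 : (0 : ℝ) ≤ s := Nat.cast_nonneg s
  have hJc : Real.log (2 * Fintype.card J) ≤ s + 2 := by
    have : (2 * Fintype.card J : ℝ) = 2 ^ (s + 2) := by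
      simp only [J, Fintype.card_prod, Fintype.card_bool, Fintype.card_finset, Fintype.card_fin]
      push_cast; ring
    rw [this, Real.log_pow]
    push_cast
    nlinarith
  have hIc : Real.log (2 * Fintype.card I + 1) ≤ 2 * s + 2 := by
    have h1 : Fintype.card I ≤ 2 ^ s * 2 ^ s := by
      refine (Fintype.card_subtype_le _).trans_eq ?_
      simp
    have h2 : (Fintype.card I : ℝ) ≤ 2 ^ s * 2 ^ s := by exact_mod_cast h1
    have h3 : (1 : ℝ) ≤ 2 ^ s * 2 ^ s := by
      have : (1 : ℝ) ≤ 2 ^ s := one_le_pow₀ (by norm_num)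
      nlinarith
    have h4 : (2 * Fintype.card I + 1 : ℝ) ≤ 2 ^ (2 * s + 2) := by
      calc (2 * Fintype.card I + 1 : ℝ) ≤ 4 * (2 ^ s * 2 ^ s) := by linarith
        _ = _ := by ring
    have h5 := Real.log_le_log (by positivity) h4
    rw [Real.log_pow] at h5
    push_cast at h5
    nlinarith
  have hbound : 2 * (Real.log (2 * Fintype.card J) + r * (Real.log (2 * Fintype.card I + 1) + 1)) ≤
      10 * (s + 1) ^ 3 * coverRate ^ s := by
    calc _ ≤ 2 * ((s + 2) + r * ((2 * s + 2) + 1)) := by gcongr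
      _ ≤ 2 * (r * (s + 2) + r * ((2 * s + 2) + 1)) := by nlinarith
      _ ≤ 10 * (s + 1) * r := by nlinarith
      _ = _ := by rw [hr]; ring
  refine ⟨F, ?_, ?_, ?_⟩
  · intro u v hu hv huv
    exact hF1 ⟨(u, v), hu, hv, huv⟩
  · intro u hu
    have := (hF2 (true, u)).trans hbound
    simpa [H, hu] using this
  · intro v hv
    have := (hF2 (false, v)).trans hbound
    simpa [H, hv] using this

/-! ### The biclique cover for blocks of constant length -/

/-- The fourth power is the cube of `exists_separating_family` times the `s + 1` possible sizes of
the other set; the `- 1` pays for rounding up to an integer. -/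
theorem exists_mul_pow_le : ∃ s : ℕ, 0 < s ∧
    10 * (s + 1 : ℝ) ^ 4 * coverRate ^ s ≤ (1.155 : ℝ) ^ s - 1 := by
  have h0 : 0 < coverRate := by norm_num [coverRate]
  set q := 1.155 / coverRate with hq
  have hq1 : 1 < q := by rw [hq, lt_div_iff₀ h0]; norm_num [coverRate]
  have h1 := (tendsto_pow_const_div_const_pow_of_one_lt 4 hq1).comp (Filter.tendsto_add_atTop_nat 1)
  have h2 : ∀ᶠ s : ℕ in Filter.atTop, ((s + 1 : ℕ) : ℝ) ^ 4 / q ^ (s + 1) < 1 / (11 * q) :=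
    h1.eventually_lt_const (by positivity)
  obtain ⟨s, hs, hs0⟩ := (h2.and (Filter.eventually_gt_atTop 0)).exists
  refine ⟨s, hs0, ?_⟩
  have hq0 : 0 < q := by linarith
  rw [div_lt_div_iff₀ (by positivity) (by positivity)] at hs
  have h3 : 11 * ((s : ℝ) + 1) ^ 4 < q ^ s := by
    push_cast at hs
    rw [pow_succ q s, one_mul, ← mul_assoc] at hs
    linarith [lt_of_mul_lt_mul_right hs hq0.le]
  have h4 : (1.155 : ℝ) ^ s = q ^ s * coverRate ^ s := by
    rw [← mul_pow, hq, div_mul_cancel₀ _ h0.ne']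
  have h5 : (1 : ℝ) ≤ coverRate ^ s := one_le_pow₀ (by norm_num [coverRate])
  have h6 : (1 : ℝ) ≤ ((s : ℝ) + 1) ^ 4 := one_le_pow₀ (by linarith [Nat.cast_nonneg (α := ℝ) s])
  rw [h4]
  nlinarith [mul_le_mul_of_nonneg_right h3.le (zero_le_one.trans h5)]

/-- Lists shorter than `k` are padded by repetition, so that every vector has the same number of
choices and a choice can be a digit in base `k`. -/
theorem exists_range_eq {ι : Type*} (N : Finset ι) (hN : N.Nonempty) (k : ℕ)
    (h : N.card ≤ k) :
    ∃ f : Fin k → ι, ∀ i, i ∈ N ↔ ∃ p, f p = i := by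
  have : Nonempty (N ↪ Fin k) := by
    apply Function.Embedding.nonempty_of_card_le; simpa
  obtain ⟨e⟩ := this
  have : Nonempty N := hN.to_subtype
  refine ⟨fun p => (Function.invFun e p : N), fun i => ⟨fun hi => ⟨e ⟨i, hi⟩, ?_⟩, ?_⟩⟩
  · exact congrArg Subtype.val (Function.leftInverse_invFun e.injective ⟨i, hi⟩)
  · rintro ⟨p, rfl⟩; exact Subtype.prop _

theorem exists_biclique_cover : ∃ (s k M : ℕ) (A B : Finset (Fin s) → Fin k → Fin M), 0 < s ∧
    (k : ℝ) ≤ (1.155 : ℝ) ^ s ∧ ∀ u v, Disjoint u v ↔ ∃ p q, A u p = B v q := by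
  classical
  obtain ⟨s, hs0, hs⟩ := exists_mul_pow_le
  have fam : ∀ a b : ℕ, ∃ F : Finset (Finset (Fin s)),
      (∀ u v : Finset (Fin s), u.card = a → v.card = b → Disjoint u v →
        ∃ W ∈ F, u ⊆ W ∧ Disjoint W v) ∧
      (∀ u : Finset (Fin s), u.card = a →
        ((F.filter (u ⊆ ·)).card : ℝ) ≤ 10 * (s + 1) ^ 3 * coverRate ^ s) ∧
      (∀ v : Finset (Fin s), v.card = b →
        ((F.filter (Disjoint · v)).card : ℝ) ≤ 10 * (s + 1) ^ 3 * coverRate ^ s) := by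
    intro a b
    by_cases hab : a + b ≤ s
    · exact exists_separating_family s a b hab
    · have : (0 : ℝ) ≤ 10 * (s + 1) ^ 3 * coverRate ^ s := by
        have : 0 ≤ coverRate := by norm_num [coverRate]
        positivity
      refine ⟨∅, ?_, by simpa using fun _ _ => this, by simpa using fun _ _ => this⟩
      intro u v hu hv huv
      have := Finset.card_le_univ (u ∪ v)
      rw [Finset.card_union_of_disjoint huv, Fintype.card_fin] at this
      omega
  choose F hF hFu hFv using fam
  -- A biclique carries the sizes `a`, `b` of its two sides, so a set meets only the families made
  -- for its own size.
  let ι := Fin (s + 1) × Fin (s + 1) × Finset (Fin s)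
  have hlt : ∀ u : Finset (Fin s), u.card < s + 1 := fun u => by
    have := Finset.card_le_univ u
    rw [Fintype.card_fin] at this
    omega
  let NU : Finset (Fin s) → Finset ι := fun u =>
    Finset.univ.filter fun z => u.card = z.1 ∧ z.2.2 ∈ F z.1 z.2.1 ∧ u ⊆ z.2.2
  let NV : Finset (Fin s) → Finset ι := fun v =>
    Finset.univ.filter fun z => v.card = z.2.1 ∧ z.2.2 ∈ F z.1 z.2.1 ∧ Disjoint z.2.2 v
  have hdisj : ∀ u v, Disjoint u v ↔ ∃ z, z ∈ NU u ∧ z ∈ NV v := by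
    intro u v
    constructor
    · intro h
      obtain ⟨W, hW, h1, h2⟩ := hF u.card v.card u v rfl rfl h
      exact ⟨(⟨_, hlt u⟩, ⟨_, hlt v⟩, W), by simp [NU, hW, h1], by simp [NV, hW, h2]⟩
    · rintro ⟨z, hu, hv⟩
      simp only [NU, NV, Finset.mem_filter, Finset.mem_univ, true_and] at hu hv
      exact hv.2.2.mono_left hu.2.2
  have hcard : ∀ (N : Finset ι) (g : ℕ → Finset (Finset (Fin s))) (e : ι → Fin (s + 1)),
      (∀ b, ((g b).card : ℝ) ≤ 10 * (s + 1) ^ 3 * coverRate ^ s) →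
      (∀ z ∈ N, z.2.2 ∈ g (e z)) → Set.InjOn (fun z => (e z, z.2.2)) N →
      (N.card : ℝ) ≤ 10 * (s + 1) ^ 4 * coverRate ^ s := by
    intro N g e hg hmem hinj
    have h1 : N.card ≤ (Finset.univ.sigma fun b : Fin (s + 1) => g b).card := by
      refine Finset.card_le_card_of_injOn (fun z => ⟨e z, z.2.2⟩) ?_ ?_
      · intro z hz
        simpa using hmem z hz
      · intro z hz z' hz' h
        apply hinj hz hz'
        simpa using h
    rw [Finset.card_sigma] at h1
    calc (N.card : ℝ) ≤ ∑ b : Fin (s + 1), ((g b).card : ℝ) := by exact_mod_cast h1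
      _ ≤ ∑ _b : Fin (s + 1), 10 * (s + 1 : ℝ) ^ 3 * coverRate ^ s :=
        Finset.sum_le_sum fun b _ => hg b
      _ = _ := by rw [Finset.sum_const, Finset.card_univ, Fintype.card_fin, nsmul_eq_mul]
                  push_cast; ring
  set k := ⌈10 * (s + 1 : ℝ) ^ 4 * coverRate ^ s⌉₊ with hk
  have hk1 : (k : ℝ) ≤ (1.155 : ℝ) ^ s := by
    have h0 : 0 ≤ coverRate := by norm_num [coverRate]
    have := Nat.ceil_lt_add_one (show 0 ≤ 10 * (s + 1 : ℝ) ^ 4 * coverRate ^ s by positivity)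
    linarith
  have hU : ∀ u, (NU u).card ≤ k := by
    intro u
    have := hcard (NU u) (fun b => (F u.card b).filter (u ⊆ ·)) (fun z => z.2.1)
      (fun b => hFu _ _ u rfl)
      (by
        intro z hz
        simp only [NU, Finset.mem_filter, Finset.mem_univ, true_and] at hz
        simpa [hz.1] using hz.2)
      (by
        rintro ⟨a, b, W⟩ hz ⟨a', b', W'⟩ hz' h
        simp only [NU, Finset.coe_filter, Finset.mem_univ, true_and, Set.mem_ofPred_eq] at hz hz'
        exact Prod.ext (Fin.ext (hz.1.symm.trans hz'.1)) h)
    exact Nat.cast_le.1 (this.trans (Nat.le_ceil _))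
  have hV : ∀ v, (NV v).card ≤ k := by
    intro v
    have := hcard (NV v) (fun a => (F a v.card).filter (Disjoint · v)) (fun z => z.1)
      (fun b => hFv _ _ v rfl)
      (by
        intro z hz
        simp only [NV, Finset.mem_filter, Finset.mem_univ, true_and] at hz
        simpa [hz.1] using hz.2)
      (by
        rintro ⟨a, b, W⟩ hz ⟨a', b', W'⟩ hz' h
        simp only [NV, Finset.coe_filter, Finset.mem_univ, true_and, Set.mem_ofPred_eq] at hz hz'
        exact Prod.ext (Prod.mk.inj h).1
          (Prod.ext (Fin.ext (hz.1.symm.trans hz'.1)) (Prod.mk.inj h).2))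
    exact Nat.cast_le.1 (this.trans (Nat.le_ceil _))
  -- Every set is disjoint from `∅`, hence lies in some biclique; padding needs this nonemptiness.
  choose A hA using fun u => exists_range_eq (NU u)
    (((hdisj u ∅).1 (Finset.disjoint_empty_right u)).imp fun _ h => h.1) k (hU u)
  choose B hB using fun v => exists_range_eq (NV v)
    (((hdisj ∅ v).1 (Finset.disjoint_empty_left v)).imp fun _ h => h.2) k (hV v)
  let E := Fintype.equivFin ι
  refine ⟨s, k, Fintype.card ι, fun u p => E (A u p), fun v q => E (B v q), hs0, hk1, ?_⟩
  intro u v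
  rw [hdisj]
  constructor
  · rintro ⟨z, hu, hv⟩
    obtain ⟨p, hp⟩ := (hA u z).1 hu
    obtain ⟨q, hq⟩ := (hB v z).1 hv
    exact ⟨p, q, by simp only [hp, hq]⟩
  · rintro ⟨p, q, h⟩
    refine ⟨A u p, (hA u _).2 ⟨p, rfl⟩, (hB v _).2 ⟨q, ?_⟩⟩
    exact (E.injective h).symm

/-! ### Expressions and loops on the machine, with logarithmic cost -/

namespace LogRAM

/-- Arithmetic expressions over the variables (the low registers) and the memory. -/
inductive Expr : Type
  | lit (c : ℕ) : Expr
  | var (r : ℕ) : Expr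
  | add (a b : Expr) : Expr
  | sub (a b : Expr) : Expr
  | mul (a b : Expr) : Expr
  | div (a b : Expr) : Expr
  | mem (a : Expr) : Expr

namespace Expr

/-- The value of an expression; `l` lists the values of the variables. -/
def eval (l : List ℕ) (μ : ℕ → ℕ) : Expr → ℕ
  | lit c => c
  | var r => l.getD r 0
  | add a b => a.eval l μ + b.eval l μ
  | sub a b => a.eval l μ - b.eval l μ
  | mul a b => a.eval l μ * b.eval l μ
  | div a b => a.eval l μ / b.eval l μ
  | mem a => μ (a.eval l μ)

/-- All variables of the expression are listed in `l`, and all values that occur during its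
evaluation are at most `X`. -/
def Fits (X : ℕ) (l : List ℕ) (μ : ℕ → ℕ) : Expr → Prop
  | lit c => c ≤ X
  | var r => r < l.length ∧ l.getD r 0 ≤ X
  | add a b => a.Fits X l μ ∧ b.Fits X l μ ∧ a.eval l μ + b.eval l μ ≤ X
  | sub a b => a.Fits X l μ ∧ b.Fits X l μ
  | mul a b => a.Fits X l μ ∧ b.Fits X l μ ∧ a.eval l μ * b.eval l μ ≤ X
  | div a b => a.Fits X l μ ∧ b.Fits X l μ
  | mem a => a.Fits X l μ ∧ μ (a.eval l μ) ≤ X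

/-- The number of instructions used to evaluate an expression. -/
def cost : Expr → ℕ
  | lit _ => 1
  | var _ => 1
  | add a b => a.cost + b.cost + 1
  | sub a b => a.cost + b.cost + 1
  | mul a b => a.cost + b.cost + 1
  | div a b => a.cost + b.cost + 1
  | mem a => a.cost + 1

/-- A program that writes the value of an expression into register `k`, using the registers
from `k` on as a stack. -/
def compile (k : ℕ) : Expr → Prog
  | lit c => .const k c
  | var r => .copy k r
  | add a b => .seq (.seq (a.compile k) (b.compile (k + 1))) (.add k k (k + 1))
  | sub a b => .seq (.seq (a.compile k) (b.compile (k + 1))) (.sub k k (k + 1))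
  | mul a b => .seq (.seq (a.compile k) (b.compile (k + 1))) (.mul k k (k + 1))
  | div a b => .seq (.seq (a.compile k) (b.compile (k + 1))) (.div k k (k + 1))
  | mem a => .seq (a.compile k) (.load k k)

theorem Fits.eval_le {X : ℕ} {l : List ℕ} {μ : ℕ → ℕ} {e : Expr} (h : e.Fits X l μ) :
    e.eval l μ ≤ X := by
  induction e with
  | lit c => exact h
  | var r => exact h.2
  | add a b => exact h.2.2
  | sub a b iha _ => exact (Nat.sub_le _ _).trans (iha h.1)
  | mul a b => exact h.2.2
  | div a b iha _ => exact (Nat.div_le_self _ _).trans (iha h.1)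
  | mem a => exact h.2

end Expr

/-- The state `σ` has the variables `l` and the memory `μ`. -/
def State.Has (σ : State) (l : List ℕ) (μ : ℕ → ℕ) : Prop :=
  (∀ r < l.length, σ.reg r = l.getD r 0) ∧ σ.mem = μ

/-- The most that an instruction costs if all the numbers it reads are at most `X`. -/
def unitCost (X : ℕ) : ℕ := 1 + 2 * X.size

theorem cost_le_unitCost {X a b : ℕ} (ha : a ≤ X) (hb : b ≤ X) :
    1 + a.size + b.size ≤ unitCost X := by
  have := Nat.size_le_size ha
  have := Nat.size_le_size hb
  unfold unitCost
  omega

theorem cost_le_unitCost' {X a : ℕ} (ha : a ≤ X) : 1 + a.size ≤ unitCost X :=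
  (Nat.le_add_right _ _).trans (cost_le_unitCost ha (Nat.zero_le X))

theorem State.Has.setReg {σ : State} {l : List ℕ} {μ : ℕ → ℕ} (h : σ.Has l μ) {k : ℕ}
    (hk : l.length ≤ k) (x : ℕ) : (σ.setReg k x).Has l μ :=
  ⟨fun r hr => by rw [← h.1 r hr]; exact Function.update_of_ne (by omega) _ _, h.2⟩

theorem State.Has.setVar {σ : State} {l : List ℕ} {μ : ℕ → ℕ} (h : σ.Has l μ) (r x : ℕ) :
    (σ.setReg r x).Has (l.set r x) μ := by
  refine ⟨fun r' hr' => ?_, h.2⟩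
  rw [List.length_set] at hr'
  by_cases hrr : r' = r
  · subst hrr
    simp [State.setReg, hr']
  · simp [State.setReg, Function.update_of_ne hrr, h.1 r' hr', List.getD_eq_getElem?_getD,
      List.getElem?_set_ne (Ne.symm hrr)]

theorem Expr.exec_binary {X : ℕ} {l : List ℕ} {μ : ℕ → ℕ} {a b : Expr} {k : ℕ}
    (iha : ∀ σ : State, σ.Has l μ → ∃ t τ, Exec (a.compile k) σ t τ ∧
      t ≤ a.cost * unitCost X ∧ τ.Has l μ ∧ τ.reg k = a.eval l μ ∧ ∀ r < k, τ.reg r = σ.reg r)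
    (ihb : ∀ σ : State, σ.Has l μ → ∃ t τ, Exec (b.compile (k + 1)) σ t τ ∧
      t ≤ b.cost * unitCost X ∧ τ.Has l μ ∧ τ.reg (k + 1) = b.eval l μ ∧
      ∀ r < k + 1, τ.reg r = σ.reg r)
    (hk : l.length ≤ k) (ha : a.eval l μ ≤ X) (hb : b.eval l μ ≤ X) (i : Prog) (f : ℕ → ℕ → ℕ)
    (hi : ∀ σ : State, Exec i σ (1 + (σ.reg k).size + (σ.reg (k + 1)).size)
      (σ.setReg k (f (σ.reg k) (σ.reg (k + 1))))) (σ : State) (h : σ.Has l μ) :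
    ∃ t τ, Exec (.seq (.seq (a.compile k) (b.compile (k + 1))) i) σ t τ ∧
      t ≤ (a.cost + b.cost + 1) * unitCost X ∧ τ.Has l μ ∧
      τ.reg k = f (a.eval l μ) (b.eval l μ) ∧ ∀ r < k, τ.reg r = σ.reg r := by
  obtain ⟨t₁, τ₁, e₁, c₁, h₁, v₁, s₁⟩ := iha σ h
  obtain ⟨t₂, τ₂, e₂, c₂, h₂, v₂, s₂⟩ := ihb τ₁ h₁
  have hx : τ₂.reg k = a.eval l μ := by rw [s₂ k (by omega), v₁]
  refine ⟨_, _, .seq (.seq e₁ e₂) (hi τ₂), ?_, h₂.setReg hk _, ?_, ?_⟩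
  · have : 1 + (τ₂.reg k).size + (τ₂.reg (k + 1)).size ≤ unitCost X := by
      rw [hx, v₂]; exact cost_le_unitCost ha hb
    rw [add_mul, add_mul, one_mul]
    omega
  · simp [State.setReg, hx, v₂]
  · intro r hr
    simp only [State.setReg]
    rw [Function.update_of_ne (by omega), s₂ r (by omega), s₁ r hr]

/-- The last clause is what the induction needs: a left operand held in register `k` survives the
evaluation of the right operand from `k + 1` on. -/
theorem Expr.exec_compile {X : ℕ} {l : List ℕ} {μ : ℕ → ℕ} (e : Expr) (h : e.Fits X l μ) (k : ℕ)
    (hk : l.length ≤ k) (σ : State) (hσ : σ.Has l μ) :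
    ∃ t τ, Exec (e.compile k) σ t τ ∧ t ≤ e.cost * unitCost X ∧ τ.Has l μ ∧
      τ.reg k = e.eval l μ ∧ ∀ r < k, τ.reg r = σ.reg r := by
  have upd : ∀ (σ : State) (x r : ℕ), r < k → (σ.setReg k x).reg r = σ.reg r := fun σ x r hr => by
    simp only [State.setReg]; rw [Function.update_of_ne (by omega)]
  induction e generalizing k σ with
  | lit c =>
    refine ⟨_, _, .const k c σ, ?_, hσ.setReg hk _, by simp [State.setReg, eval], upd σ _⟩
    rw [cost, one_mul]; exact cost_le_unitCost' h
  | var r =>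
    have hr := hσ.1 r h.1
    refine ⟨_, _, .copy k r σ, ?_, hσ.setReg hk _, by simp [State.setReg, eval, hr], upd σ _⟩
    rw [cost, one_mul, hr]; exact cost_le_unitCost' h.2
  | add a b iha ihb =>
    exact exec_binary (fun σ hσ => iha h.1 k hk σ hσ upd)
      (fun σ hσ => ihb h.2.1 (k + 1) (by omega) σ hσ fun σ x r hr => by
        simp only [State.setReg]; rw [Function.update_of_ne (by omega)])
      hk h.1.eval_le h.2.1.eval_le _ _ (fun σ => .add k k (k + 1) σ) σ hσ
  | sub a b iha ihb =>
    exact exec_binary (fun σ hσ => iha h.1 k hk σ hσ upd)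
      (fun σ hσ => ihb h.2 (k + 1) (by omega) σ hσ fun σ x r hr => by
        simp only [State.setReg]; rw [Function.update_of_ne (by omega)])
      hk h.1.eval_le h.2.eval_le _ _ (fun σ => .sub k k (k + 1) σ) σ hσ
  | mul a b iha ihb =>
    exact exec_binary (fun σ hσ => iha h.1 k hk σ hσ upd)
      (fun σ hσ => ihb h.2.1 (k + 1) (by omega) σ hσ fun σ x r hr => by
        simp only [State.setReg]; rw [Function.update_of_ne (by omega)])
      hk h.1.eval_le h.2.1.eval_le _ _ (fun σ => .mul k k (k + 1) σ) σ hσ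
  | div a b iha ihb =>
    exact exec_binary (fun σ hσ => iha h.1 k hk σ hσ upd)
      (fun σ hσ => ihb h.2 (k + 1) (by omega) σ hσ fun σ x r hr => by
        simp only [State.setReg]; rw [Function.update_of_ne (by omega)])
      hk h.1.eval_le h.2.eval_le _ _ (fun σ => .div k k (k + 1) σ) σ hσ
  | mem a iha =>
    obtain ⟨t, τ, e, c, h₁, v, s⟩ := iha h.1 k hk σ hσ upd
    refine ⟨_, _, .seq e (.load k k τ), ?_, h₁.setReg hk _, ?_, ?_⟩
    · have : 1 + (τ.reg k).size + (τ.mem (τ.reg k)).size ≤ unitCost X := by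
        rw [v, h₁.2]; exact cost_le_unitCost h.1.eval_le h.2
      rw [cost, add_mul, one_mul]
      omega
    · simp [State.setReg, v, h₁.2, eval]
    · intro r hr
      rw [upd _ _ r hr, s r hr]

/-- From variables `l` and memory `μ`, the program `p` leads to variables `l'` and memory `μ'`,
executing at most `n` instructions, all on numbers that are at most `X`. -/
def Runs (X : ℕ) (p : Prog) (n : ℕ) (l : List ℕ) (μ : ℕ → ℕ) (l' : List ℕ) (μ' : ℕ → ℕ) : Prop :=
  ∀ σ : State, σ.Has l μ → ∃ t τ, Exec p σ t τ ∧ t ≤ n * unitCost X ∧ τ.Has l' μ'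

variable {X n n₁ n₂ V : ℕ} {p q : Prog} {l l₁ l₂ : List ℕ} {μ μ₁ μ₂ : ℕ → ℕ}

theorem Runs.seq (hp : Runs X p n₁ l μ l₁ μ₁) (hq : Runs X q n₂ l₁ μ₁ l₂ μ₂) :
    Runs X (.seq p q) (n₁ + n₂) l μ l₂ μ₂ := by
  intro σ h
  obtain ⟨t₁, τ₁, e₁, c₁, h₁⟩ := hp σ h
  obtain ⟨t₂, τ₂, e₂, c₂, h₂⟩ := hq τ₁ h₁
  refine ⟨_, _, .seq e₁ e₂, ?_, h₂⟩
  rw [add_mul]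
  omega

theorem Runs.mono (hp : Runs X p n₁ l μ l₁ μ₁) (h : n₁ ≤ n₂) : Runs X p n₂ l μ l₁ μ₁ := by
  intro σ hσ
  obtain ⟨t, τ, e, c, h'⟩ := hp σ hσ
  exact ⟨t, τ, e, c.trans (by gcongr), h'⟩

theorem Runs.skip : Runs X .skip 1 l μ l μ := fun σ h =>
  ⟨_, _, .skip σ, by rw [unitCost]; omega, h⟩

/-- `var r := e`, for `r < V`, with the registers from `V` on free -/
def assign (V r : ℕ) (e : Expr) : Prog := .seq (e.compile V) (.copy r V)

theorem Runs.assign {e : Expr} {r : ℕ} (hV : l.length = V) (h : e.Fits X l μ) :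
    Runs X (assign V r e) (e.cost + 1) l μ (l.set r (e.eval l μ)) μ := by
  intro σ hσ
  obtain ⟨t, τ, ex, c, h₁, v, -⟩ := e.exec_compile h V hV.le σ hσ
  refine ⟨_, _, .seq ex (.copy r V τ), ?_, ?_⟩
  · have : 1 + (τ.reg V).size ≤ unitCost X := by rw [v]; exact cost_le_unitCost' h.eval_le
    rw [add_mul, one_mul]
    omega
  · rw [v]; exact h₁.setVar r _

/-- `mem a := e` -/
def storeAt (V : ℕ) (a e : Expr) : Prog :=
  .seq (.seq (a.compile V) (e.compile (V + 1))) (.store V (V + 1))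

theorem Runs.storeAt {a e : Expr} (hV : l.length = V) (ha : a.Fits X l μ) (he : e.Fits X l μ) :
    Runs X (storeAt V a e) (a.cost + e.cost + 1) l μ l
      (Function.update μ (a.eval l μ) (e.eval l μ)) := by
  intro σ hσ
  obtain ⟨t₁, τ₁, e₁, c₁, h₁, v₁, s₁⟩ := a.exec_compile ha V hV.le σ hσ
  obtain ⟨t₂, τ₂, e₂, c₂, h₂, v₂, s₂⟩ := e.exec_compile he (V + 1) (by omega) τ₁ h₁
  have hx : τ₂.reg V = a.eval l μ := by rw [s₂ V (by omega), v₁]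
  refine ⟨_, _, .seq (.seq e₁ e₂) (.store V (V + 1) τ₂), ?_, h₂.1, ?_⟩
  · have : 1 + (τ₂.reg V).size + (τ₂.reg (V + 1)).size ≤ unitCost X := by
      rw [hx, v₂]; exact cost_le_unitCost ha.eval_le he.eval_le
    rw [add_mul, add_mul, one_mul]
    omega
  · simp [State.setMem, hx, v₂, h₂.2]

/-- For the values `0, 1, …` of `var r` (which is `0` before and after the loop) up to the value of
`e`, exclusively, run `p`. -/
def forLoop (V r : ℕ) (e : Expr) (p : Prog) : Prog :=
  .seq ((Expr.sub e (.var r)).compile V)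
    (.seq (.loop V (.seq p (.seq (assign V r (.add (.var r) (.lit 1)))
      ((Expr.sub e (.var r)).compile V)))) (assign V r (.lit 0)))

/-- `L i` lists the variables at the start of round `i`, `T i` those after the body but before the
increment. Register `V` holds the number of remaining rounds, recomputed in each round, so the body
may use it as scratch. -/
theorem Runs.forLoop {r N : ℕ} {e : Expr} (L T : ℕ → List ℕ) (m : ℕ → ℕ → ℕ) (hNX : N ≤ X)
    (hr : r < V) (hL : ∀ i ≤ N, (L i).length = V ∧ (L i).getD r 0 = i)
    (hT : ∀ i < N, (T i).length = V ∧ (T i).getD r 0 = i ∧ (T i).set r (i + 1) = L (i + 1))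
    (he : ∀ i ≤ N, e.Fits X (L i) (m i) ∧ e.eval (L i) (m i) = N)
    (hp : ∀ i < N, Runs X p n (L i) (m i) (T i) (m (i + 1))) :
    Runs X (forLoop V r e p) (N * (n + e.cost + 7) + e.cost + 5) (L 0) (m 0)
      ((L N).set r 0) (m N) := by
  set g := Expr.sub e (.var r) with hg
  have gfits : ∀ i ≤ N, g.Fits X (L i) (m i) := fun i hi =>
    ⟨(he i hi).1, by rw [(hL i hi).1]; exact hr, by rw [(hL i hi).2]; omega⟩
  have geval : ∀ i ≤ N, g.eval (L i) (m i) = N - i := fun i hi => by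
    change e.eval (L i) (m i) - (L i).getD r 0 = N - i
    rw [(he i hi).2, (hL i hi).2]
  have main : ∀ k ≤ N, ∀ σ : State, σ.Has (L (N - k)) (m (N - k)) → σ.reg V = k →
      ∃ t τ, Exec (.loop V (.seq p (.seq (LogRAM.assign V r (.add (.var r) (.lit 1)))
        (g.compile V)))) σ t τ ∧ t ≤ (k * (n + e.cost + 7) + 1) * unitCost X ∧
        τ.Has (L N) (m N) := by
    intro k
    induction k with
    | zero =>
      intro _ σ hσ hv
      refine ⟨_, _, .loop_false hv, ?_, hσ⟩
      rw [zero_mul, zero_add, one_mul, hv]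
      exact cost_le_unitCost' (Nat.zero_le _)
    | succ k ih =>
      intro hk σ hσ hv
      have hi : N - (k + 1) < N := by omega
      have hi1 : N - (k + 1) + 1 = N - k := by omega
      obtain ⟨t₁, τ₁, e₁, c₁, h₁⟩ := hp _ hi σ hσ
      obtain ⟨hTl, hTr, hTs⟩ := hT _ hi
      have inc : (Expr.add (.var r) (.lit 1)).Fits X (T (N - (k + 1))) (m (N - (k + 1) + 1)) :=
        ⟨⟨by omega, by omega⟩, by change 1 ≤ X; omega, by
          change (T (N - (k + 1))).getD r 0 + 1 ≤ X; omega⟩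
      obtain ⟨t₂, τ₂, e₂, c₂, h₂⟩ := Runs.assign (r := r) hTl inc τ₁ h₁
      have hev : (Expr.add (.var r) (.lit 1)).eval (T (N - (k + 1))) (m (N - (k + 1) + 1)) =
          N - (k + 1) + 1 := by
        change (T (N - (k + 1))).getD r 0 + 1 = _
        rw [hTr]
      rw [hev, hTs, hi1] at h₂
      obtain ⟨t₃, τ₃, e₃, c₃, h₃, v₃, -⟩ := g.exec_compile (gfits (N - k) (by omega)) V
        (hL (N - k) (by omega)).1.le τ₂ h₂
      rw [geval _ (by omega), show N - (N - k) = k by omega] at v₃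
      obtain ⟨t₄, τ₄, e₄, c₄, h₄⟩ := ih (by omega) τ₃ h₃ v₃
      refine ⟨_, _, .loop_true (by omega) (.seq e₁ (.seq e₂ e₃)) e₄, ?_, h₄⟩
      have c₀ : 1 + (σ.reg V).size ≤ unitCost X := cost_le_unitCost' (by omega)
      have c₂' : (Expr.add (.var r) (.lit 1)).cost + 1 = 4 := rfl
      have c₃' : g.cost = e.cost + 2 := rfl
      rw [c₂'] at c₂
      rw [c₃'] at c₃
      calc _ ≤ unitCost X + (n * unitCost X + (4 * unitCost X + (e.cost + 2) * unitCost X)) +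
            (k * (n + e.cost + 7) + 1) * unitCost X := by omega
        _ = _ := by ring
  intro σ hσ
  obtain ⟨t₁, τ₁, e₁, c₁, h₁, v₁, -⟩ := g.exec_compile (gfits 0 (Nat.zero_le _)) V
    (hL 0 (Nat.zero_le _)).1.le σ hσ
  rw [geval 0 (Nat.zero_le _), Nat.sub_zero] at v₁
  obtain ⟨t₂, τ₂, e₂, c₂, h₂⟩ := main N le_rfl τ₁ (by rwa [Nat.sub_self]) v₁
  obtain ⟨t₃, τ₃, e₃, c₃, h₃⟩ := Runs.assign (X := X) (r := r) (e := .lit 0) (hL N le_rfl).1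
    (Nat.zero_le X) τ₂ h₂
  refine ⟨_, _, .seq e₁ (.seq e₂ e₃), ?_, h₃⟩
  have c₁' : g.cost = e.cost + 2 := rfl
  have c₃' : (Expr.lit 0).cost + 1 = 2 := rfl
  rw [c₁'] at c₁
  rw [c₃'] at c₃
  calc _ ≤ (e.cost + 2) * unitCost X + ((N * (n + e.cost + 7) + 1) * unitCost X +
        2 * unitCost X) := by omega
    _ = _ := by ring

end LogRAM

/-! ### The program and its execution -/

namespace OrthogonalVectors

open LogRAM

/-- The value of the first `k` binary digits `b 0, b 1, …`, the most significant one first. -/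
def binaryVal (b : ℕ → ℕ) : ℕ → ℕ
  | 0 => 0
  | k + 1 => 2 * binaryVal b k + b k

theorem binaryVal_lt {b : ℕ → ℕ} (hb : ∀ p, b p ≤ 1) (k : ℕ) : binaryVal b k < 2 ^ k := by
  induction k with
  | zero => simp [binaryVal]
  | succ k ih => rw [binaryVal, pow_succ]; have := hb k; omega

/-- The `j`-th block of length `s` of the vector `b`, as a number. -/
def block (s : ℕ) (b : ℕ → ℕ) (j : ℕ) : ℕ := binaryVal (fun k => b (j * s + k)) s

/-- The number, in base `M`, whose `j`-th digit is the entry of the table `F` (from `o` on, with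
rows of length `Δ`) in the row of the `j`-th block of `b` and the column of the `j`-th digit of `c`
in base `Δ`. -/
def code (F : ℕ → ℕ) (s Δ M o : ℕ) (b : ℕ → ℕ) (c : ℕ) : ℕ → ℕ
  | 0 => 0
  | j + 1 => code F s Δ M o b c j * M + F (o + (block s b j * Δ + c / Δ ^ j % Δ))

/-- The variables of the program: `n`, the dimension `d`, the number `m` of blocks, the number `N`
of choices, the address `T` of the table, the loop counters `i, c, j, k`, the current block, the
choices that remain to be made, the current code, and the result. -/
abbrev vars (n d m N T i c j k blk e w f : ℕ) : List ℕ := [n, d, m, N, T, i, c, j, k, blk, e, w, f]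

def posExpr (s : ℕ) : Expr := .add (.mul (.var 7) (.lit s)) (.var 8)

/-- `2 * blk + bit`, where `bit` is the current bit of the current vector, and `0` beyond its end;
the vectors start at `off` -/
def blockExpr (s : ℕ) (off : Expr) : Expr :=
  .add (.mul (.lit 2) (.var 9))
    (.mul (.mem (.add (.add off (.mul (.var 5) (.var 1))) (posExpr s)))
      (.sub (.lit 1) (.sub (.lit 1) (.sub (.var 1) (posExpr s)))))

def blockProg (s : ℕ) (off : Expr) : Prog :=
  forLoop 13 8 (.lit s) (assign 13 9 (blockExpr s off))

def codeExpr (Δ M o : ℕ) : Expr :=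
  .add (.mul (.var 11) (.lit M))
    (.mem (.add (.add (.var 4) (.lit o)) (.add (.mul (.var 9) (.lit Δ))
      (.sub (.var 10) (.mul (.div (.var 10) (.lit Δ)) (.lit Δ))))))

def stepProg (s Δ M o : ℕ) (off : Expr) : Prog :=
  .seq (blockProg s off) (.seq (assign 13 11 (codeExpr Δ M o))
    (.seq (assign 13 10 (.div (.var 10) (.lit Δ))) (assign 13 9 (.lit 0))))

/-- computes the code that belongs to the `i`-th vector and the choice `c` -/
def codeProg (s Δ M o : ℕ) (off : Expr) : Prog :=
  .seq (assign 13 10 (.var 6)) (forLoop 13 7 (.var 2) (stepProg s Δ M o off))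

/-- runs `act` for the codes of all vectors and all choices -/
def passProg (s Δ M o : ℕ) (off : Expr) (act : Prog) : Prog :=
  forLoop 13 5 (.var 0) (forLoop 13 6 (.var 3)
    (.seq (codeProg s Δ M o off) (.seq act (assign 13 11 (.lit 0)))))

/-- The bound `X` is large enough for all numbers that occur. -/
structure Fitting (X s Δ M n d m N T : ℕ) : Prop where
  s_pos : 0 < s
  Δ_pos : 0 < Δ
  m_pos : 0 < m
  N_eq : N = Δ ^ m
  two_pow : 2 ^ (s + 1) ≤ X
  input : n * d + n * d + m * s ≤ X
  nodes : T + 2 * (2 ^ s * Δ) + M ^ m ≤ X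
  M_le : M ≤ X
  N_le : N ≤ X
  d_le : d ≤ X
  n_le : n ≤ X
  m_le : m ≤ X
  mul_le : n * N ≤ X

/-- The memory holds the vector `b` from `a` on and the table `F` from `T` on. -/
structure Holds (X s Δ M d T : ℕ) (F : ℕ → ℕ) (a : ℕ) (b : ℕ → ℕ) (μ : ℕ → ℕ) : Prop where
  le : ∀ x, μ x ≤ X
  bit_le : ∀ p, b p ≤ 1
  bit : ∀ p < d, μ (a + p) = b p
  zero : ∀ p, d ≤ p → b p = 0
  table : ∀ x < 2 * (2 ^ s * Δ), μ (T + x) = F x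
  table_lt : ∀ x < 2 * (2 ^ s * Δ), F x < M

variable {X s Δ M n d m N T i c j o a : ℕ} {F b μ : ℕ → ℕ} {off : Expr}

theorem block_lt (hb : ∀ p, b p ≤ 1) (j : ℕ) : block s b j < 2 ^ s := binaryVal_lt (fun _ => hb _) _

theorem index_lt (hb : ∀ p, b p ≤ 1) (hΔ : 0 < Δ) (ho : o ≤ 2 ^ s * Δ) (c j : ℕ) :
    o + (block s b j * Δ + c / Δ ^ j % Δ) < 2 * (2 ^ s * Δ) := by
  have h1 : c / Δ ^ j % Δ < Δ := Nat.mod_lt _ hΔ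
  have h2 : (block s b j + 1) * Δ ≤ 2 ^ s * Δ := Nat.mul_le_mul_right _ (block_lt hb j)
  rw [add_mul, one_mul] at h2
  omega

theorem code_lt (H : Holds X s Δ M d T F a b μ) (hΔ : 0 < Δ) (ho : o ≤ 2 ^ s * Δ) (c j : ℕ) :
    code F s Δ M o b c j < M ^ j := by
  induction j with
  | zero => simp [code]
  | succ j ih =>
    have h1 := H.table_lt _ (index_lt H.bit_le hΔ ho c j)
    have h2 := Nat.mul_le_mul_right M (Nat.succ_le_of_lt ih)
    rw [Nat.succ_mul] at h2
    rw [code, pow_succ]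
    omega

/-- `K` is chosen before the instance: only the constant block length and the offset expression
enter the instruction count. -/
theorem runs_blockProg (s : ℕ) (off : Expr) : ∃ K, ∀ {X Δ M n d m N T i c j e w f a : ℕ}
    {F b μ : ℕ → ℕ}, Fitting X s Δ M n d m N T → Holds X s Δ M d T F (a + i * d) b μ → i < n →
    j < m → a ≤ n * d →
    (∀ k blk, off.Fits X (vars n d m N T i c j k blk e w f) μ ∧
      off.eval (vars n d m N T i c j k blk e w f) μ = a) →
    Runs X (blockProg s off) K (vars n d m N T i c j 0 0 e w f) μ
      (vars n d m N T i c j 0 (block s b j) e w f) μ := by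
  refine ⟨s * ((blockExpr s off).cost + 1 + (Expr.lit s).cost + 7) + (Expr.lit s).cost + 5,
    fun {X Δ M n d m N T i c j e w f a F b μ} hX H hi hj ha hoff => ?_⟩
  have h2 := hX.two_pow
  have hs : s < 2 ^ s := Nat.lt_two_pow_self
  have hs' : 2 ^ (s + 1) = 2 ^ s * 2 := pow_succ _ _
  have hid : i * d + d ≤ n * d := by
    have := Nat.mul_le_mul_right d (Nat.succ_le_of_lt hi)
    rwa [Nat.succ_mul] at this
  have hjs : j * s + s ≤ m * s := by
    have := Nat.mul_le_mul_right s (Nat.succ_le_of_lt hj)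
    rwa [Nat.succ_mul] at this
  have hin := hX.input
  have hd := hX.d_le
  refine Runs.forLoop (L := fun k => vars n d m N T i c j k
      (binaryVal (fun k => b (j * s + k)) k) e w f)
    (T := fun k => vars n d m N T i c j k (binaryVal (fun k => b (j * s + k)) (k + 1)) e w f)
    (m := fun _ => μ) (N := s) (by omega) (by norm_num) (fun k _ => ⟨rfl, rfl⟩)
    (fun k _ => ⟨rfl, rfl, rfl⟩) (fun k _ => ⟨by change s ≤ X; omega, rfl⟩) ?_
  intro k hk
  set B := binaryVal (fun k => b (j * s + k)) k with hB
  have hBlt : B < 2 ^ k := binaryVal_lt (fun _ => H.bit_le _) k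
  have hpow : 2 ^ k ≤ 2 ^ s := Nat.pow_le_pow_right (by norm_num) hk.le
  obtain ⟨hf, he⟩ := hoff k B
  -- By truncation `1 - (1 - (d - pos))` is the indicator of `pos < d`; it masks whatever memory
  -- holds behind the vector.
  have hbit : μ (a + i * d + (j * s + k)) * (1 - (1 - (d - (j * s + k)))) = b (j * s + k) := by
    rcases lt_or_ge (j * s + k) d with h | h
    · rw [H.bit _ h, show 1 - (1 - (d - (j * s + k))) = 1 by omega, mul_one]
    · rw [H.zero _ h, show 1 - (1 - (d - (j * s + k))) = 0 by omega, mul_zero]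
  have hb1 := H.bit_le (j * s + k)
  have hpos : (posExpr s).Fits X (vars n d m N T i c j k B e w f) μ :=
    ⟨⟨⟨by norm_num, show j ≤ X by have := hX.m_le; omega⟩, show s ≤ X by omega,
      show j * s ≤ X by omega⟩, ⟨by norm_num, show k ≤ X by omega⟩, show j * s + k ≤ X by omega⟩
  have hfit : (blockExpr s off).Fits X (vars n d m N T i c j k B e w f) μ := by
    refine ⟨⟨show 2 ≤ X by omega, ⟨by norm_num, show B ≤ X by omega⟩, show 2 * B ≤ X by omega⟩,
      ⟨⟨⟨⟨hf, ⟨⟨by norm_num, show i ≤ X by have := hX.n_le; omega⟩, ⟨by norm_num, hd⟩,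
        show i * d ≤ X by omega⟩, ?_⟩, hpos, ?_⟩, H.le _⟩,
        ⟨show 1 ≤ X by omega, show 1 ≤ X by omega, ⟨by norm_num, hd⟩, hpos⟩, ?_⟩, ?_⟩
    · rw [he]; change a + i * d ≤ X; omega
    · change off.eval _ μ + i * d + (j * s + k) ≤ X
      rw [he]; omega
    · change μ (off.eval _ μ + i * d + (j * s + k)) * (1 - (1 - (d - (j * s + k)))) ≤ X
      rw [he, hbit]; omega
    · change 2 * B + μ (off.eval _ μ + i * d + (j * s + k)) * (1 - (1 - (d - (j * s + k)))) ≤ X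
      rw [he, hbit]; omega
  have heval : (blockExpr s off).eval (vars n d m N T i c j k B e w f) μ =
      binaryVal (fun k => b (j * s + k)) (k + 1) := by
    change 2 * B + μ (off.eval _ μ + i * d + (j * s + k)) * (1 - (1 - (d - (j * s + k)))) = _
    rw [he, hbit]; rfl
  have := Runs.assign (V := 13) (r := 9) rfl hfit
  rw [heval] at this
  exact this

theorem runs_stepProg (s Δ M o : ℕ) (off : Expr) (ho : o ≤ 2 ^ s * Δ) :
    ∃ K, ∀ {X n d m N T i c j f a : ℕ} {F b μ : ℕ → ℕ}, Fitting X s Δ M n d m N T →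
    Holds X s Δ M d T F (a + i * d) b μ → i < n → c < N → j < m → a ≤ n * d →
    (∀ k blk e w, off.Fits X (vars n d m N T i c j k blk e w f) μ ∧
      off.eval (vars n d m N T i c j k blk e w f) μ = a) →
    Runs X (stepProg s Δ M o off) K
      (vars n d m N T i c j 0 0 (c / Δ ^ j) (code F s Δ M o b c j) f) μ
      (vars n d m N T i c j 0 0 (c / Δ ^ (j + 1)) (code F s Δ M o b c (j + 1)) f) μ := by
  obtain ⟨K₁, h₁⟩ := runs_blockProg s off
  refine ⟨K₁ + ((codeExpr Δ M o).cost + 1 + (4 + 2)),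
    fun {X n d m N T i c j f a F b μ} hX H hi hc hj ha hoff => ?_⟩
  refine (h₁ hX H hi hj ha fun k blk => hoff k blk _ _).seq (Runs.seq
    (n₁ := (codeExpr Δ M o).cost + 1)
    (μ₁ := μ)
    (l₁ := vars n d m N T i c j 0 (block s b j) (c / Δ ^ j) (code F s Δ M o b c (j + 1)) f) ?_
    (Runs.seq (n₁ := 4) (μ₁ := μ)
    (l₁ := vars n d m N T i c j 0 (block s b j) (c / Δ ^ (j + 1)) (code F s Δ M o b c (j + 1)) f)
    ?_ ?_))
  · set e := c / Δ ^ j with he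
    have heX : e ≤ X := (Nat.div_le_self _ _).trans (hc.le.trans hX.N_le)
    have hidx := index_lt H.bit_le hX.Δ_pos ho c j
    rw [← he] at hidx
    have hcode := code_lt H hX.Δ_pos ho c (j + 1)
    have hpow : M ^ (j + 1) ≤ M ^ m := by
      rcases Nat.eq_zero_or_pos M with rfl | hM
      · have := H.table_lt 0 (by have := hX.Δ_pos; positivity)
        omega
      · exact Nat.pow_le_pow_right hM hj
    have hnodes := hX.nodes
    have hmod : e - e / Δ * Δ = e % Δ := by
      rw [Nat.mod_eq_sub_mul_div, mul_comm]
    have hΔ : Δ ≤ 2 ^ s * Δ := Nat.le_mul_of_pos_left _ (by positivity)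
    have hmodlt : e % Δ < Δ := Nat.mod_lt _ hX.Δ_pos
    have hdiv : e / Δ * Δ ≤ e := Nat.div_mul_le_self _ _
    have hcode' : code F s Δ M o b c (j + 1) =
      code F s Δ M o b c j * M + F (o + (block s b j * Δ + e % Δ)) := rfl
    have hT : μ (T + o + (block s b j * Δ + (e - e / Δ * Δ))) =
        F (o + (block s b j * Δ + e % Δ)) := by
      rw [hmod, add_assoc, H.table _ hidx]
    have hw : code F s Δ M o b c j ≤ code F s Δ M o b c j * M := by
      rcases Nat.eq_zero_or_pos M with rfl | hM
      · have := H.table_lt 0 (by have := hX.Δ_pos; positivity)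
        omega
      · exact Nat.le_mul_of_pos_right _ hM
    have hfit : (codeExpr Δ M o).Fits X
        (vars n d m N T i c j 0 (block s b j) e (code F s Δ M o b c j) f) μ := by
      refine ⟨⟨⟨by norm_num, show code F s Δ M o b c j ≤ X by omega⟩, hX.M_le,
        show code F s Δ M o b c j * M ≤ X by omega⟩,
        ⟨⟨⟨⟨by norm_num, show T ≤ X by omega⟩, show o ≤ X by omega, show T + o ≤ X by omega⟩,
        ⟨⟨⟨by norm_num, show block s b j ≤ X from ?_⟩, show Δ ≤ X by omega,
          show block s b j * Δ ≤ X by omega⟩,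
          ⟨⟨by norm_num, heX⟩, ⟨⟨by norm_num, heX⟩, show Δ ≤ X by omega⟩, show Δ ≤ X by omega,
            show e / Δ * Δ ≤ X by omega⟩, ?_⟩, ?_⟩, H.le _⟩, ?_⟩
      · have := block_lt (s := s) H.bit_le j
        have := hX.two_pow
        have : 2 ^ (s + 1) = 2 ^ s * 2 := pow_succ _ _
        omega
      · change block s b j * Δ + (e - e / Δ * Δ) ≤ X
        rw [hmod]; omega
      · change T + o + (block s b j * Δ + (e - e / Δ * Δ)) ≤ X
        rw [hmod]; omega
      · change code F s Δ M o b c j * M + μ (T + o + (block s b j * Δ + (e - e / Δ * Δ))) ≤ X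
        rw [hT]; omega
    have heval : (codeExpr Δ M o).eval
        (vars n d m N T i c j 0 (block s b j) e (code F s Δ M o b c j) f) μ =
        code F s Δ M o b c (j + 1) := by
      change code F s Δ M o b c j * M + μ (T + o + (block s b j * Δ + (e - e / Δ * Δ))) = _
      rw [hT]; rfl
    have := Runs.assign (V := 13) (r := 11) rfl hfit
    rw [heval] at this
    exact this
  · have heX : c / Δ ^ j ≤ X := (Nat.div_le_self _ _).trans (hc.le.trans hX.N_le)
    have hnodes := hX.nodes
    have hΔ : Δ ≤ 2 ^ s * Δ := Nat.le_mul_of_pos_left _ (by positivity)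
    have := Runs.assign (X := X) (V := 13) (r := 10) (e := .div (.var 10) (.lit Δ)) (μ := μ)
      (l := vars n d m N T i c j 0 (block s b j) (c / Δ ^ j) (code F s Δ M o b c (j + 1)) f) rfl
      ⟨⟨by norm_num, heX⟩, show Δ ≤ X by omega⟩
    rw [pow_succ, ← Nat.div_div_eq_div_mul]
    exact this
  · exact Runs.assign (X := X) (V := 13) (r := 9) (e := .lit 0) (μ := μ)
      (l := vars n d m N T i c j 0 (block s b j) (c / Δ ^ (j + 1)) (code F s Δ M o b c (j + 1)) f)
      rfl (Nat.zero_le X)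

theorem runs_codeProg (s Δ M o : ℕ) (off : Expr) (ho : o ≤ 2 ^ s * Δ) :
    ∃ K, ∀ {X n d m N T i c f a : ℕ} {F b μ : ℕ → ℕ}, Fitting X s Δ M n d m N T →
    Holds X s Δ M d T F (a + i * d) b μ → i < n → c < N → a ≤ n * d →
    (∀ j k blk e w, off.Fits X (vars n d m N T i c j k blk e w f) μ ∧
      off.eval (vars n d m N T i c j k blk e w f) μ = a) →
    Runs X (codeProg s Δ M o off) (K * m) (vars n d m N T i c 0 0 0 0 0 f) μ
      (vars n d m N T i c 0 0 0 0 (code F s Δ M o b c m) f) μ := by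
  obtain ⟨K₁, h₁⟩ := runs_stepProg s Δ M o off ho
  refine ⟨K₁ + 16, fun {X n d m N T i c f a F b μ} hX H hi hc ha hoff => ?_⟩
  have e1 : Runs X (assign 13 10 (.var 6)) 2 (vars n d m N T i c 0 0 0 0 0 f) μ
      (vars n d m N T i c 0 0 0 c 0 f) μ :=
    Runs.assign (V := 13) rfl ⟨by norm_num, hc.le.trans hX.N_le⟩
  have e2 := Runs.forLoop (X := X) (n := K₁) (V := 13) (r := 7) (N := m) (e := .var 2)
    (p := stepProg s Δ M o off)
    (L := fun j => vars n d m N T i c j 0 0 (c / Δ ^ j) (code F s Δ M o b c j) f)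
    (T := fun j => vars n d m N T i c j 0 0 (c / Δ ^ (j + 1)) (code F s Δ M o b c (j + 1)) f)
    (m := fun _ => μ) hX.m_le (by norm_num) (fun k _ => ⟨rfl, rfl⟩) (fun k _ => ⟨rfl, rfl, rfl⟩)
    (fun k _ => ⟨⟨by norm_num, hX.m_le⟩, rfl⟩) fun j hj => h₁ hX H hi hc hj ha (hoff j)
  -- After `m` digits the remaining choice is `0`, so this variable returns to its initial value by
  -- itself.
  have hdiv : c / Δ ^ m = 0 := Nat.div_eq_of_lt (by rwa [← hX.N_eq])
  have e3 : c / Δ ^ 0 = c := by simp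
  simp only [hdiv, e3] at e2
  refine (e1.seq e2).mono ?_
  have := hX.m_pos
  have hc1 : (Expr.var 2).cost = 1 := rfl
  rw [hc1]
  nlinarith

/-- One statement serves both passes: in the marking pass `act` changes only the memory `μ i c`, in
the lookup pass only the result `f i c`. -/
theorem runs_passProg (s Δ M o : ℕ) (off : Expr) (act : Prog) (ho : o ≤ 2 ^ s * Δ) (K₀ : ℕ) :
    ∃ K, ∀ {X n d m N T a : ℕ} {F : ℕ → ℕ} {b : ℕ → ℕ → ℕ} (μ : ℕ → ℕ → ℕ → ℕ) (f : ℕ → ℕ → ℕ),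
    Fitting X s Δ M n d m N T →
    (∀ i < n, ∀ c < N, Holds X s Δ M d T F (a + i * d) (b i) (μ i c)) → 0 < n → a ≤ n * d →
    (∀ i c j k blk e w f μ, off.Fits X (vars n d m N T i c j k blk e w f) μ ∧
      off.eval (vars n d m N T i c j k blk e w f) μ = a) →
    (∀ i < n, ∀ c < N, Runs X act K₀
      (vars n d m N T i c 0 0 0 0 (code F s Δ M o (b i) c m) (f i c)) (μ i c)
      (vars n d m N T i c 0 0 0 0 (code F s Δ M o (b i) c m) (f i (c + 1))) (μ i (c + 1))) →
    (∀ i, μ i N = μ (i + 1) 0) → (∀ i, f i N = f (i + 1) 0) →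
    Runs X (passProg s Δ M o off act) (K * (n * N * m))
      (vars n d m N T 0 0 0 0 0 0 0 (f 0 0)) (μ 0 0)
      (vars n d m N T 0 0 0 0 0 0 0 (f n 0)) (μ n 0) := by
  obtain ⟨K₁, h₁⟩ := runs_codeProg s Δ M o off ho
  refine ⟨K₁ + K₀ + 40, fun {X n d m N T a F b} μ f hX H hn ha hoff hact hμ hf => ?_⟩
  have inner : ∀ i < n, Runs X (forLoop 13 6 (.var 3)
      (.seq (codeProg s Δ M o off) (.seq act (assign 13 11 (.lit 0)))))
      (N * (K₁ * m + (K₀ + 2) + (Expr.var 3).cost + 7) + (Expr.var 3).cost + 5)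
      (vars n d m N T i 0 0 0 0 0 0 (f i 0)) (μ i 0)
      (vars n d m N T i 0 0 0 0 0 0 (f (i + 1) 0)) (μ (i + 1) 0) := by
    intro i hi
    have := Runs.forLoop (X := X) (n := K₁ * m + (K₀ + 2)) (V := 13) (r := 6) (N := N) (e := .var 3)
      (p := .seq (codeProg s Δ M o off) (.seq act (assign 13 11 (.lit 0))))
      (L := fun c => vars n d m N T i c 0 0 0 0 0 (f i c))
      (T := fun c => vars n d m N T i c 0 0 0 0 0 (f i (c + 1)))
      (m := fun c => μ i c) hX.N_le (by norm_num) (fun c _ => ⟨rfl, rfl⟩)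
      (fun c _ => ⟨rfl, rfl, rfl⟩) (fun c _ => ⟨⟨by norm_num, hX.N_le⟩, rfl⟩) ?_
    · simp only [hμ, hf] at this
      exact this
    · intro c hc
      refine (h₁ hX (H i hi c hc) hi hc ha fun j k blk e w => hoff ..).seq
        ((hact i hi c hc).seq ?_)
      exact Runs.assign (X := X) (V := 13) (r := 11) (e := .lit 0) (μ := μ i (c + 1))
        (l := vars n d m N T i c 0 0 0 0 (code F s Δ M o (b i) c m) (f i (c + 1)))
        rfl (Nat.zero_le X)
  have outer := Runs.forLoop (X := X) (V := 13) (r := 5) (N := n) (e := .var 0)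
      (L := fun i => vars n d m N T i 0 0 0 0 0 0 (f i 0))
      (T := fun i => vars n d m N T i 0 0 0 0 0 0 (f (i + 1) 0))
      (m := fun i => μ i 0) hX.n_le (by norm_num) (fun c _ => ⟨rfl, rfl⟩)
      (fun c _ => ⟨rfl, rfl, rfl⟩) (fun c _ => ⟨⟨by norm_num, hX.n_le⟩, rfl⟩) inner
  refine outer.mono ?_
  have hm := hX.m_pos
  have hN : 0 < N := by rw [hX.N_eq]; exact Nat.pow_pos hX.Δ_pos
  have c3 : (Expr.var 3).cost = 1 := rfl
  have c0 : (Expr.var 0).cost = 1 := rfl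
  rw [c3, c0]
  have i1 : N * (K₁ * m + (K₀ + 2) + 1 + 7) + 1 + 5 + 1 + 7 ≤ (K₁ + K₀ + 24) * (N * m) := by
    have : 1 ≤ N * m := Nat.mul_pos hN hm
    have : N ≤ N * m := Nat.le_mul_of_pos_right _ hm
    nlinarith [Nat.mul_le_mul_left K₀ this]
  have i2 : 1 ≤ n * (N * m) := Nat.mul_pos hn (Nat.mul_pos hN hm)
  calc _ ≤ n * ((K₁ + K₀ + 24) * (N * m)) + 1 + 5 := by gcongr
    _ ≤ (K₁ + K₀ + 24) * (n * (N * m)) + 16 * (n * (N * m)) := by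
      rw [mul_left_comm]; omega
    _ = _ := by ring

/-- writes the table `F 0, …, F (k - 1)` to the addresses from `var 4` on -/
def tableProg (F : ℕ → ℕ) : ℕ → Prog
  | 0 => .skip
  | k + 1 => .seq (tableProg F k) (storeAt 13 (.add (.var 4) (.lit k)) (.lit (F k)))

/-- the memory after writing the table -/
def tableMem (F : ℕ → ℕ) (T : ℕ) (μ : ℕ → ℕ) (k x : ℕ) : ℕ :=
  if T ≤ x ∧ x < T + k then F (x - T) else μ x

theorem runs_tableProg {X n d m N T L : ℕ} {F μ : ℕ → ℕ} (hX : T + L ≤ X) (hF : ∀ x < L, F x ≤ X)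
    (k : ℕ) (hk : k ≤ L) :
    Runs X (tableProg F k) (5 * k + 1) (vars n d m N T 0 0 0 0 0 0 0 0) μ
      (vars n d m N T 0 0 0 0 0 0 0 0) (tableMem F T μ k) := by
  induction k with
  | zero =>
    have : tableMem F T μ 0 = μ := by
      funext x
      exact if_neg (by omega)
    rw [this]
    exact Runs.skip
  | succ k ih =>
    have h1 := (ih (by omega)).seq (Runs.storeAt (X := X) (V := 13) (a := .add (.var 4) (.lit k))
      (e := .lit (F k)) rfl ⟨⟨by norm_num, show T ≤ X by omega⟩, show k ≤ X by omega,
        show T + k ≤ X by omega⟩ (hF k (by omega)))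
    have : Function.update (tableMem F T μ k) (T + k) (F k) = tableMem F T μ (k + 1) := by
      funext x
      unfold tableMem
      by_cases hx : x = T + k
      · subst hx
        rw [Function.update_self, if_pos (by omega), Nat.add_sub_cancel_left]
      · rw [Function.update_of_ne hx]
        exact if_congr (by omega) rfl rfl
    rw [← this]
    refine Runs.mono h1 ?_
    simp only [Expr.cost]
    omega

/-- the program for blocks of length `s` with the table `F` -/
def mainProg (s Δ M : ℕ) (F : ℕ → ℕ) : Prog :=
  .seq (assign 13 2 (.add (.div (.var 1) (.lit s)) (.lit 1)))
  (.seq (assign 13 3 (.lit 1))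
  (.seq (forLoop 13 7 (.var 2) (assign 13 3 (.mul (.var 3) (.lit Δ))))
  (.seq (assign 13 4 (.add (.mul (.var 0) (.var 1)) (.mul (.var 0) (.var 1))))
  (.seq (tableProg F (2 * (2 ^ s * Δ)))
  (.seq (passProg s Δ M 0 (.lit 0)
    (storeAt 13 (.add (.add (.var 4) (.lit (2 * (2 ^ s * Δ)))) (.var 11)) (.lit 1)))
  (.seq (passProg s Δ M (2 ^ s * Δ) (.mul (.var 0) (.var 1))
    (assign 13 12 (.add (.var 12)
      (.mem (.add (.add (.var 4) (.lit (2 * (2 ^ s * Δ)))) (.var 11))))))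
  (assign 13 0 (.sub (.lit 1) (.sub (.lit 1) (.var 12))))))))))

open Classical in
/-- the memory after marking the cells `w i' c'` for the pairs `(i', c')` before `(i, c)` -/
noncomputable def marked (μ : ℕ → ℕ) (w : ℕ → ℕ → ℕ) (N i c x : ℕ) : ℕ :=
  if ∃ i' c', c' < N ∧ (i' < i ∨ i' = i ∧ c' < c) ∧ x = w i' c' then 1 else μ x

theorem marked_zero (μ : ℕ → ℕ) (w : ℕ → ℕ → ℕ) (N : ℕ) : marked μ w N 0 0 = μ := by
  funext x
  exact if_neg (by rintro ⟨i', c', h1, h2, h3⟩; omega)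

theorem marked_succ (μ : ℕ → ℕ) (w : ℕ → ℕ → ℕ) {N c : ℕ} (i : ℕ) (hc : c < N) :
    Function.update (marked μ w N i c) (w i c) 1 = marked μ w N i (c + 1) := by
  classical
  funext x
  unfold marked
  by_cases hx : x = w i c
  · subst hx
    rw [Function.update_self, if_pos ⟨i, c, hc, Or.inr ⟨rfl, by omega⟩, rfl⟩]
  · rw [Function.update_of_ne hx]
    refine if_congr ⟨?_, ?_⟩ rfl rfl
    · rintro ⟨i', c', h1, h2, h3⟩
      exact ⟨i', c', h1, by omega, h3⟩
    · rintro ⟨i', c', h1, h2, h3⟩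
      refine ⟨i', c', h1, ?_, h3⟩
      rcases h2 with h2 | ⟨rfl, h2⟩
      · exact Or.inl h2
      · refine Or.inr ⟨rfl, ?_⟩
        rcases (Nat.lt_succ_iff.1 h2).lt_or_eq with h | rfl
        · exact h
        · exact absurd h3 hx

theorem marked_next (μ : ℕ → ℕ) (w : ℕ → ℕ → ℕ) (N i : ℕ) :
    marked μ w N i N = marked μ w N (i + 1) 0 := by
  classical
  funext x
  refine if_congr ⟨?_, ?_⟩ rfl rfl
  · rintro ⟨i', c', h1, h2, h3⟩
    exact ⟨i', c', h1, by omega, h3⟩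
  · rintro ⟨i', c', h1, h2, h3⟩
    exact ⟨i', c', h1, by omega, h3⟩

/-- the sum of `g i' c'` over the pairs `(i', c')` before `(i, c)` -/
def partialSum (g : ℕ → ℕ → ℕ) (N i c : ℕ) : ℕ :=
  ∑ i' ∈ Finset.range i, ∑ c' ∈ Finset.range N, g i' c' + ∑ c' ∈ Finset.range c, g i c'

theorem partialSum_le {g : ℕ → ℕ → ℕ} (hg : ∀ i c, g i c ≤ 1) (N i c : ℕ) :
    partialSum g N i c ≤ i * N + c := by
  have h1 : ∑ i' ∈ Finset.range i, ∑ c' ∈ Finset.range N, g i' c' ≤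
      ∑ i' ∈ Finset.range i, ∑ c' ∈ Finset.range N, 1 :=
    Finset.sum_le_sum fun _ _ => Finset.sum_le_sum fun _ _ => hg _ _
  have h2 : ∑ c' ∈ Finset.range c, g i c' ≤ ∑ c' ∈ Finset.range c, 1 :=
    Finset.sum_le_sum fun _ _ => hg _ _
  simp only [Finset.sum_const, Finset.card_range, smul_eq_mul, mul_one] at h1 h2
  exact add_le_add h1 h2

/-- The input of the program: `n` vectors `U i` and `n` vectors `V i`. -/
structure Input (n d : ℕ) (U V : ℕ → ℕ → ℕ) (μ : ℕ → ℕ) : Prop where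
  bitU_le : ∀ i p, U i p ≤ 1
  bitV_le : ∀ i p, V i p ≤ 1
  bitU : ∀ i < n, ∀ p < d, μ (i * d + p) = U i p
  bitV : ∀ i < n, ∀ p < d, μ (n * d + i * d + p) = V i p
  zeroU : ∀ i p, d ≤ p → U i p = 0
  zeroV : ∀ i p, d ≤ p → V i p = 0
  le : ∀ x, μ x ≤ 1
  zero : ∀ x, n * d + n * d ≤ x → μ x = 0

open Classical in
theorem runs_mainProg (s Δ M : ℕ) (F : ℕ → ℕ) (hF : ∀ x < 2 * (2 ^ s * Δ), F x < M) :
    ∃ K, ∀ {X n d m N : ℕ} {U V : ℕ → ℕ → ℕ} {μ : ℕ → ℕ}, m = d / s + 1 →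
    Fitting X s Δ M n d m N (n * d + n * d) → Input n d U V μ → 0 < n →
    ∃ l μ', Runs X (mainProg s Δ M F) (K * (n * N * m)) (vars n d 0 0 0 0 0 0 0 0 0 0 0) μ
      ((if ∃ i < n, ∃ j < n, ∃ c < N, ∃ c' < N,
        code F s Δ M 0 (U i) c m = code F s Δ M (2 ^ s * Δ) (V j) c' m then 1 else 0) :: l) μ' := by
  obtain ⟨K₁, h₁⟩ := runs_passProg s Δ M 0 (.lit 0)
    (storeAt 13 (.add (.add (.var 4) (.lit (2 * (2 ^ s * Δ)))) (.var 11)) (.lit 1))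
    (Nat.zero_le _) 7
  obtain ⟨K₂, h₂⟩ := runs_passProg s Δ M (2 ^ s * Δ) (.mul (.var 0) (.var 1))
    (assign 13 12 (.add (.var 12)
      (.mem (.add (.add (.var 4) (.lit (2 * (2 ^ s * Δ)))) (.var 11))))) le_rfl 9
  refine ⟨K₁ + K₂ + (5 * (2 * (2 ^ s * Δ)) + 60), fun {X n d m N U V μ} hm hX hI hn => ?_⟩
  set L := 2 * (2 ^ s * Δ) with hL
  set T := n * d + n * d with hT
  set μ₁ := tableMem F T μ L with hμ₁
  set w : ℕ → ℕ → ℕ := fun i c => T + L + code F s Δ M 0 (U i) c m with hw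
  set w' : ℕ → ℕ → ℕ := fun i c => T + L + code F s Δ M (2 ^ s * Δ) (V i) c m with hw'
  set μ₂ := marked μ₁ w N n 0 with hμ₂
  have hX1 := hX.two_pow
  have hXin := hX.input
  have hXno := hX.nodes
  have hML := hX.M_le
  have hX2 : 2 ≤ X := by
    have : 0 < 2 ^ s := by positivity
    rw [pow_succ] at hX1
    omega
  -- All marks lie beyond the input and the table, so both stay readable while marking goes on.
  have low : ∀ i c x, x < T + L → marked μ₁ w N i c x = μ₁ x := by
    intro i c x hx
    refine if_neg ?_
    rintro ⟨i', c', -, -, rfl⟩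
    simp only [hw] at hx
    omega
  have le₁ : ∀ x, μ₁ x ≤ X := by
    intro x
    simp only [hμ₁, tableMem]
    split_ifs with h
    · have := hF (x - T) (by omega); omega
    · have := hI.le x; omega
  have leM : ∀ i c x, marked μ₁ w N i c x ≤ X := by
    intro i c x
    unfold marked
    split_ifs
    · omega
    · exact le₁ x
  have inp : ∀ x < T, μ₁ x = μ x := fun x hx => if_neg (by omega)
  have tab : ∀ x < L, μ₁ (T + x) = F x := fun x hx => by
    rw [hμ₁, tableMem, if_pos (by omega), Nat.add_sub_cancel_left]
  have row : ∀ i < n, ∀ p < d, i * d + p < n * d := fun i hi p hp => by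
    have := Nat.mul_le_mul_right d (Nat.succ_le_of_lt hi)
    rw [Nat.succ_mul] at this
    omega
  have holdsU : ∀ i < n, ∀ i' c, Holds X s Δ M d T F (0 + i * d) (U i) (marked μ₁ w N i' c) := by
    intro i hi i' c
    refine ⟨leM _ _, hI.bitU_le i, fun p hp => ?_, hI.zeroU i, fun x hx => ?_, hF⟩
    · have := row i hi p hp
      rw [low _ _ _ (by omega), inp _ (by omega), zero_add, hI.bitU i hi p hp]
    · rw [low _ _ _ (by omega), tab x hx]
  have holdsV : ∀ i < n, Holds X s Δ M d T F (n * d + i * d) (V i) μ₂ := by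
    intro i hi
    refine ⟨leM _ _, hI.bitV_le i, fun p hp => ?_, hI.zeroV i, fun x hx => ?_, hF⟩
    · have := row i hi p hp
      rw [hμ₂, low _ _ _ (by omega), inp _ (by omega), hI.bitV i hi p hp]
    · rw [hμ₂, low _ _ _ (by omega), tab x hx]
  have fitAddr : ∀ {i c e w f : ℕ} {μ : ℕ → ℕ}, w ≤ M ^ m →
      (Expr.add (.add (.var 4) (.lit L)) (.var 11)).Fits X
        (vars n d m N T i c 0 0 0 e w f) μ := fun {i c e w f μ} hw =>
    ⟨⟨⟨by norm_num, show T ≤ X by omega⟩, show L ≤ X by omega, show T + L ≤ X by omega⟩,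
      ⟨by norm_num, show w ≤ X by omega⟩, show T + L + w ≤ X by omega⟩
  have s₁ : Runs X (assign 13 2 (.add (.div (.var 1) (.lit s)) (.lit 1))) 6
      (vars n d 0 0 0 0 0 0 0 0 0 0 0) μ (vars n d m 0 0 0 0 0 0 0 0 0 0) μ := by
    rw [hm]
    refine Runs.assign (V := 13) rfl ⟨⟨⟨by norm_num, hX.d_le⟩, ?_⟩, show 1 ≤ X by omega, ?_⟩
    · change s ≤ X
      have : s < 2 ^ s := Nat.lt_two_pow_self
      rw [pow_succ] at hX1
      omega
    · change d / s + 1 ≤ X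
      rw [← hm]; exact hX.m_le
  have s₂ : Runs X (assign 13 3 (.lit 1)) 2 (vars n d m 0 0 0 0 0 0 0 0 0 0) μ
      (vars n d m 1 0 0 0 0 0 0 0 0 0) μ :=
    Runs.assign (V := 13) rfl (show 1 ≤ X by omega)
  have powX : ∀ j ≤ m, Δ ^ j ≤ X := fun j hj =>
    (Nat.pow_le_pow_right hX.Δ_pos hj).trans (hX.N_eq ▸ hX.N_le)
  have s₃ : Runs X (forLoop 13 7 (.var 2) (assign 13 3 (.mul (.var 3) (.lit Δ))))
      (m * (4 + 1 + 7) + 1 + 5) (vars n d m 1 0 0 0 0 0 0 0 0 0) μ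
      (vars n d m N 0 0 0 0 0 0 0 0 0) μ := by
    have := Runs.forLoop (X := X) (n := 4) (V := 13) (r := 7) (N := m) (e := .var 2)
      (p := assign 13 3 (.mul (.var 3) (.lit Δ)))
      (L := fun j => vars n d m (Δ ^ j) 0 0 0 j 0 0 0 0 0)
      (T := fun j => vars n d m (Δ ^ (j + 1)) 0 0 0 j 0 0 0 0 0)
      (m := fun _ => μ) hX.m_le (by norm_num) (fun k _ => ⟨rfl, rfl⟩) (fun k _ => ⟨rfl, rfl, rfl⟩)
      (fun k _ => ⟨⟨by norm_num, hX.m_le⟩, rfl⟩) ?_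
    · rw [← hX.N_eq] at this
      exact this
    · intro j hj
      have := powX (j + 1) hj
      rw [pow_succ] at this
      exact Runs.assign (V := 13) rfl ⟨⟨by norm_num, powX j hj.le⟩, show Δ ≤ X by
        have := powX 1 hX.m_pos
        rwa [pow_one] at this, this⟩
  have s₄ : Runs X (assign 13 4 (.add (.mul (.var 0) (.var 1)) (.mul (.var 0) (.var 1)))) 8
      (vars n d m N 0 0 0 0 0 0 0 0 0) μ (vars n d m N T 0 0 0 0 0 0 0 0) μ :=
    have h : (Expr.mul (.var 0) (.var 1)).Fits X (vars n d m N 0 0 0 0 0 0 0 0 0) μ :=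
      ⟨⟨by norm_num, hX.n_le⟩, ⟨by norm_num, hX.d_le⟩, show n * d ≤ X by omega⟩
    Runs.assign (V := 13) rfl ⟨h, h, show n * d + n * d ≤ X by omega⟩
  have s₅ : Runs X (tableProg F L) (5 * L + 1) (vars n d m N T 0 0 0 0 0 0 0 0) μ
      (vars n d m N T 0 0 0 0 0 0 0 0) μ₁ :=
    runs_tableProg (X := X) (L := L) (by omega) (fun x hx => (hF x hx).le.trans hML) L le_rfl
  have s₆ := h₁ (X := X) (n := n) (d := d) (m := m) (N := N) (T := T) (a := 0) (F := F) (b := U)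
    (fun i c => marked μ₁ w N i c) (fun _ _ => 0) hX (fun i hi c _ => holdsU i hi i c) hn
    (Nat.zero_le _) (fun _ _ _ _ _ _ _ _ _ => ⟨Nat.zero_le _, rfl⟩)
    (fun i hi c hc => by
      rw [← marked_succ μ₁ w i hc]
      exact Runs.storeAt (V := 13) rfl
        (fitAddr (code_lt (holdsU i hi 0 0) hX.Δ_pos (Nat.zero_le _) c m).le)
        (show 1 ≤ X by omega))
    (fun i => marked_next μ₁ w N i) (fun _ => rfl)
  rw [marked_zero] at s₆
  have high : ∀ x, T + L ≤ x → μ₁ x = 0 := fun x hx => by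
    rw [hμ₁, tableMem, if_neg (by omega), hI.zero x (by omega)]
  -- No initialisation of the `M ^ m` possible cells is needed: the memory beyond the table is still
  -- zero.
  have mark : ∀ i c, μ₂ (w' i c) = if ∃ i' < n, ∃ c' < N, w i' c' = w' i c then 1 else 0 := by
    intro i c
    rw [hμ₂, marked, high (w' i c) (Nat.le_add_right _ _)]
    refine if_congr ⟨?_, ?_⟩ rfl rfl
    · rintro ⟨i', c', h1, h2, h3⟩
      exact ⟨i', by omega, c', h1, h3.symm⟩
    · rintro ⟨i', h1, c', h2, h3⟩
      exact ⟨i', c', h2, Or.inl h1, h3.symm⟩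
  set g : ℕ → ℕ → ℕ := fun i c => μ₂ (w' i c) with hg
  have hg1 : ∀ i c, g i c ≤ 1 := fun i c => by
    simp only [hg, mark]
    split_ifs <;> omega
  have s₇ := h₂ (X := X) (n := n) (d := d) (m := m) (N := N) (T := T) (a := n * d) (F := F) (b := V)
    (fun _ _ => μ₂) (partialSum g N) hX (fun i hi _ _ => holdsV i hi) hn le_rfl
    (fun _ _ _ _ _ _ _ _ _ => ⟨⟨⟨by norm_num, hX.n_le⟩, ⟨by norm_num, hX.d_le⟩,
      show n * d ≤ X by omega⟩, rfl⟩)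
    (fun i hi c hc => by
      have hle : partialSum g N i (c + 1) ≤ X := by
        have h1 := partialSum_le hg1 N i (c + 1)
        have h2 := Nat.mul_le_mul_right N (Nat.succ_le_of_lt hi)
        rw [Nat.succ_mul] at h2
        have := hX.mul_le
        omega
      have hsum : partialSum g N i (c + 1) = partialSum g N i c + g i c := by
        simp only [partialSum, Finset.sum_range_succ, add_assoc]
      rw [hsum] at hle ⊢
      exact Runs.assign (V := 13) rfl ⟨⟨by norm_num, show partialSum g N i c ≤ X by omega⟩,
        ⟨fitAddr (code_lt (holdsV i hi) hX.Δ_pos le_rfl c m).le, leM _ _ _⟩, hle⟩)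
    (fun _ => rfl) (fun i => by simp [partialSum, Finset.sum_range_succ])
  have hfin : 1 - (1 - partialSum g N n 0) = if ∃ i < n, ∃ j < n, ∃ c < N, ∃ c' < N,
      code F s Δ M 0 (U i) c m = code F s Δ M (2 ^ s * Δ) (V j) c' m then 1 else 0 := by
    split_ifs with h
    · obtain ⟨i, hi, j, hj, c, hc, c', hc', h⟩ := h
      have h1 : g j c' = 1 := by
        simp only [hg, mark]
        exact if_pos ⟨i, hi, c, hc, by simp only [hw, hw', h]⟩
      have h2 : g j c' ≤ ∑ c' ∈ Finset.range N, g j c' :=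
        Finset.single_le_sum (f := g j) (fun _ _ => Nat.zero_le _) (Finset.mem_range.2 hc')
      have h3 : ∑ c' ∈ Finset.range N, g j c' ≤
          ∑ i' ∈ Finset.range n, ∑ c' ∈ Finset.range N, g i' c' :=
        Finset.single_le_sum (f := fun j => ∑ c' ∈ Finset.range N, g j c')
          (fun _ _ => Nat.zero_le _) (Finset.mem_range.2 hj)
      have : 1 ≤ partialSum g N n 0 := by
        unfold partialSum
        omega
      omega
    · have : partialSum g N n 0 = 0 := by
        simp only [partialSum, Finset.range_zero, Finset.sum_empty, add_zero]
        refine Finset.sum_eq_zero fun j hj => Finset.sum_eq_zero fun c' hc' => ?_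
        simp only [hg, mark]
        refine if_neg ?_
        rintro ⟨i, hi, c, hc, he⟩
        exact h ⟨i, hi, j, Finset.mem_range.1 hj, c, hc, c', Finset.mem_range.1 hc',
          Nat.add_left_cancel he⟩
      omega
  have s₈ : Runs X (assign 13 0 (.sub (.lit 1) (.sub (.lit 1) (.var 12)))) 6
      (vars n d m N T 0 0 0 0 0 0 0 (partialSum g N n 0)) μ₂
      (vars (1 - (1 - partialSum g N n 0)) d m N T 0 0 0 0 0 0 0 (partialSum g N n 0)) μ₂ :=
    Runs.assign (V := 13) rfl ⟨show 1 ≤ X by omega, show 1 ≤ X by omega, by norm_num, by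
      have h1 := partialSum_le hg1 N n 0
      have := hX.mul_le
      change partialSum g N n 0 ≤ X
      omega⟩
  rw [hfin] at s₈
  have hs7 : partialSum g N 0 0 = 0 := by simp [partialSum]
  rw [hs7] at s₇
  refine ⟨_, _, (s₁.seq (s₂.seq (s₃.seq (s₄.seq (s₅.seq (s₆.seq (s₇.seq s₈))))))).mono ?_⟩
  have hN : 0 < N := by rw [hX.N_eq]; exact Nat.pow_pos hX.Δ_pos
  have hnN : 1 ≤ n * N := Nat.mul_pos hn hN
  have hm' : m ≤ n * N * m := Nat.le_mul_of_pos_left _ hnN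
  have hm1 := hX.m_pos
  have : L ≤ L * (n * N * m) := Nat.le_mul_of_pos_right _ (by omega)
  nlinarith

/-! ### Equal codes and orthogonality -/

theorem eq_of_binaryVal_eq {b b' : ℕ → ℕ} (hb : ∀ p, b p ≤ 1) (hb' : ∀ p, b' p ≤ 1) {k : ℕ}
    (h : binaryVal b k = binaryVal b' k) {p : ℕ} (hp : p < k) : b p = b' p := by
  induction k with
  | zero => omega
  | succ k ih =>
    rw [binaryVal, binaryVal] at h
    have h1 := hb k
    have h2 := hb' k
    rcases (Nat.lt_succ_iff.1 hp).lt_or_eq with h3 | rfl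
    · exact ih (by omega) h3
    · omega

open Classical in
/-- the set of positions of the ones in the binary digits of `x` -/
noncomputable def ones (s x : ℕ) : Finset (Fin s) :=
  Finset.univ.filter fun q => ∃ b : ℕ → ℕ, (∀ p, b p ≤ 1) ∧ binaryVal b s = x ∧ b q = 1

theorem mem_ones_block {s : ℕ} {b : ℕ → ℕ} (hb : ∀ p, b p ≤ 1) (j : ℕ) (q : Fin s) :
    q ∈ ones s (block s b j) ↔ b (j * s + q) = 1 := by
  simp only [ones, Finset.mem_filter, Finset.mem_univ, true_and]
  constructor
  · rintro ⟨b', hb', h, h1⟩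
    rw [← h1]
    exact (eq_of_binaryVal_eq hb' (fun _ => hb _) h q.2).symm
  · exact fun h => ⟨fun k => b (j * s + k), fun _ => hb _, rfl, h⟩

theorem exists_digits {Δ : ℕ} (hΔ : 0 < Δ) (m : ℕ) (q : ℕ → ℕ) (hq : ∀ j, q j < Δ) :
    ∃ c < Δ ^ m, ∀ j < m, c / Δ ^ j % Δ = q j := by
  induction m generalizing q with
  | zero => exact ⟨0, by simp, by simp⟩
  | succ m ih =>
    obtain ⟨c, hc, h⟩ := ih (fun j => q (j + 1)) fun j => hq _
    have h0 := hq 0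
    refine ⟨q 0 + Δ * c, ?_, ?_⟩
    · have := Nat.mul_le_mul_left Δ (Nat.succ_le_of_lt hc)
      rw [Nat.mul_succ] at this
      rw [pow_succ']
      omega
    · intro j hj
      cases j with
      | zero => rw [pow_zero, Nat.div_one, Nat.add_mul_mod_self_left, Nat.mod_eq_of_lt h0]
      | succ j =>
        rw [pow_succ', ← Nat.div_div_eq_div_mul, Nat.add_mul_div_left _ _ hΔ,
          Nat.div_eq_of_lt h0, zero_add]
        exact h j (by omega)

/-- All table entries are below `M`, so digits in base `M` are unique. -/
theorem code_eq_code_iff {F : ℕ → ℕ} {s Δ M o o' : ℕ} {b b' : ℕ → ℕ} (hΔ : 0 < Δ)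
    (hF : ∀ x < 2 * (2 ^ s * Δ), F x < M) (hb : ∀ p, b p ≤ 1) (hb' : ∀ p, b' p ≤ 1)
    (ho : o ≤ 2 ^ s * Δ) (ho' : o' ≤ 2 ^ s * Δ) (c c' m : ℕ) :
    code F s Δ M o b c m = code F s Δ M o' b' c' m ↔
      ∀ j < m, F (o + (block s b j * Δ + c / Δ ^ j % Δ)) =
        F (o' + (block s b' j * Δ + c' / Δ ^ j % Δ)) := by
  induction m with
  | zero => simp [code]
  | succ m ih =>
    have h1 := hF _ (index_lt hb hΔ ho c m)
    have h2 := hF _ (index_lt hb' hΔ ho' c' m)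
    rw [code, code]
    constructor
    · intro h
      have e1 : code F s Δ M o b c m = code F s Δ M o' b' c' m := by
        have := congrArg (· / M) h
        simpa only [mul_comm _ M, Nat.mul_add_div (show 0 < M by omega), Nat.div_eq_of_lt h1,
          Nat.div_eq_of_lt h2, add_zero] using this
      rw [e1] at h
      intro j hj
      rcases (Nat.lt_succ_iff.1 hj).lt_or_eq with h3 | rfl
      · exact ih.1 e1 j h3
      · omega
    · intro h
      rw [ih.2 fun j hj => h j (by omega), h m (by omega)]

/-- The table of a biclique cover `A`, `B`: first the entries of `A`, then the entries of `B`. -/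
noncomputable def coverTable {s k M : ℕ} (A B : Finset (Fin s) → Fin k → Fin M) (x : ℕ) : ℕ :=
  if h : 0 < k then
    if x < 2 ^ s * k then (A (ones s (x / k)) ⟨x % k, Nat.mod_lt _ h⟩ : ℕ)
    else (B (ones s ((x - 2 ^ s * k) / k)) ⟨(x - 2 ^ s * k) % k, Nat.mod_lt _ h⟩ : ℕ)
  else 0

section Cover

variable {s k M : ℕ} {A B : Finset (Fin s) → Fin k → Fin M}

theorem coverTable_lt (hk : 0 < k) (x : ℕ) : coverTable A B x < M := by
  unfold coverTable
  rw [dif_pos hk]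
  split_ifs <;> exact Fin.is_lt _

theorem coverTable_left {y q : ℕ} (hy : y < 2 ^ s) (hq : q < k) :
    coverTable A B (0 + (y * k + q)) = A (ones s y) ⟨q, hq⟩ := by
  have hk : 0 < k := by omega
  have h1 := Nat.mul_le_mul_right k (Nat.succ_le_of_lt hy)
  rw [Nat.succ_mul] at h1
  have h2 : (y * k + q) / k = y := by
    rw [mul_comm, Nat.mul_add_div hk, Nat.div_eq_of_lt hq, add_zero]
  have h3 : (y * k + q) % k = q := by rw [mul_comm, Nat.mul_add_mod, Nat.mod_eq_of_lt hq]
  unfold coverTable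
  rw [dif_pos hk, zero_add, if_pos (by omega)]
  simp only [h2, h3]

theorem coverTable_right {y q : ℕ} (hq : q < k) :
    coverTable A B (2 ^ s * k + (y * k + q)) = B (ones s y) ⟨q, hq⟩ := by
  have hk : 0 < k := by omega
  have h2 : (y * k + q) / k = y := by
    rw [mul_comm, Nat.mul_add_div hk, Nat.div_eq_of_lt hq, add_zero]
  have h3 : (y * k + q) % k = q := by rw [mul_comm, Nat.mul_add_mod, Nat.mod_eq_of_lt hq]
  unfold coverTable
  rw [dif_pos hk, if_neg (by omega)]
  simp only [Nat.add_sub_cancel_left, h2, h3]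

theorem exists_code_eq_iff (hs : 0 < s) (hk : 0 < k)
    (hAB : ∀ u v, Disjoint u v ↔ ∃ p q, A u p = B v q) {d : ℕ} {b b' : ℕ → ℕ}
    (hb : ∀ p, b p ≤ 1) (hb' : ∀ p, b' p ≤ 1) (hb0 : ∀ p, d ≤ p → b p = 0) :
    (∃ c < k ^ (d / s + 1), ∃ c' < k ^ (d / s + 1),
      code (coverTable A B) s k M 0 b c (d / s + 1) =
        code (coverTable A B) s k M (2 ^ s * k) b' c' (d / s + 1)) ↔
      ∀ p < d, ¬ (b p = 1 ∧ b' p = 1) := by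
  have hF : ∀ x < 2 * (2 ^ s * k), coverTable A B x < M := fun x _ => coverTable_lt hk x
  have entry : ∀ c c' j, coverTable A B (0 + (block s b j * k + c / k ^ j % k)) =
      coverTable A B (2 ^ s * k + (block s b' j * k + c' / k ^ j % k)) ↔
      A (ones s (block s b j)) ⟨c / k ^ j % k, Nat.mod_lt _ hk⟩ =
        B (ones s (block s b' j)) ⟨c' / k ^ j % k, Nat.mod_lt _ hk⟩ := by
    intro c c' j
    rw [coverTable_left (block_lt hb j) (Nat.mod_lt _ hk), coverTable_right (Nat.mod_lt _ hk),
      Fin.ext_iff]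
  have disj : ∀ j, Disjoint (ones s (block s b j)) (ones s (block s b' j)) ↔
      ∀ q < s, ¬ (b (j * s + q) = 1 ∧ b' (j * s + q) = 1) := by
    intro j
    rw [Finset.disjoint_left]
    constructor
    · rintro h q hq ⟨h1, h2⟩
      exact h ((mem_ones_block hb j ⟨q, hq⟩).2 h1) ((mem_ones_block hb' j ⟨q, hq⟩).2 h2)
    · intro h q h1 h2
      exact h q q.2 ⟨(mem_ones_block hb j q).1 h1, (mem_ones_block hb' j q).1 h2⟩
  constructor
  · rintro ⟨c, -, c', -, h⟩ p hp
    rw [code_eq_code_iff hk hF hb hb' (Nat.zero_le _) le_rfl] at h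
    have h1 := (entry c c' (p / s)).1
      (h (p / s) (Nat.lt_succ_of_le (Nat.div_le_div_right hp.le)))
    have h2 := (disj (p / s)).1 ((hAB _ _).2 ⟨_, _, h1⟩) (p % s) (Nat.mod_lt _ hs)
    rwa [mul_comm, Nat.div_add_mod] at h2
  · intro h
    have h1 : ∀ j, ∃ p q, A (ones s (block s b j)) p = B (ones s (block s b' j)) q := by
      intro j
      rw [← hAB, disj]
      rintro q - ⟨h2, h3⟩
      -- Positions from `d` on only pad the last block; `b` vanishes there and causes no conflict.
      rcases lt_or_ge (j * s + q) d with h4 | h4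
      · exact h _ h4 ⟨h2, h3⟩
      · rw [hb0 _ h4] at h2
        omega
    choose P Q hPQ using h1
    obtain ⟨c, hc, hc'⟩ := exists_digits hk (d / s + 1) (fun j => P j) fun j => (P j).2
    obtain ⟨e, he, he'⟩ := exists_digits hk (d / s + 1) (fun j => Q j) fun j => (Q j).2
    refine ⟨c, hc, e, he, ?_⟩
    rw [code_eq_code_iff hk hF hb hb' (Nat.zero_le _) le_rfl]
    intro j hj
    rw [entry]
    simp only [hc' j hj, he' j hj, hPQ]

end Cover

/-- the entry `(i, p)` of a boolean matrix as a number, and `0` outside the matrix -/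
def bitNat {n d : ℕ} (u : Fin n → Fin d → Bool) (i p : ℕ) : ℕ :=
  if h : i < n ∧ p < d then (u ⟨i, h.1⟩ ⟨p, h.2⟩).toNat else 0

theorem bitNat_le {n d : ℕ} (u : Fin n → Fin d → Bool) (i p : ℕ) : bitNat u i p ≤ 1 := by
  unfold bitNat
  split_ifs
  · exact Bool.toNat_le _
  · omega

theorem bitNat_fin {n d : ℕ} (u : Fin n → Fin d → Bool) (i : Fin n) (p : Fin d) :
    bitNat u i p = (u i p).toNat := by
  unfold bitNat
  rw [dif_pos ⟨i.2, p.2⟩]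

theorem eq_of_mul_add_eq {d i i' p p' : ℕ} (hp : p < d) (hp' : p' < d)
    (h : i * d + p = i' * d + p') : i = i' ∧ p = p' := by
  have h0 : 0 < d := by omega
  have h1 : i = i' := by
    have := congrArg (· / d) h
    simpa only [mul_comm _ d, Nat.mul_add_div h0, Nat.div_eq_of_lt hp, Nat.div_eq_of_lt hp',
      add_zero] using this
  subst h1
  exact ⟨rfl, by omega⟩

theorem input_initState {n d : ℕ} (u v : Fin n → Fin d → Bool) :
    Input n d (bitNat u) (bitNat v) (initState u v).mem := by
  have lt : ∀ {i p : ℕ}, i < n → p < d → i * d + p < n * d := fun {i p} hi hp => by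
    have := Nat.mul_le_mul_right d (Nat.succ_le_of_lt hi)
    rw [Nat.succ_mul] at this
    omega
  refine ⟨bitNat_le u, bitNat_le v, fun i hi p hp => ?_, fun i hi p hp => ?_, fun i p hp => ?_,
    fun i p hp => ?_, fun x => ?_, fun x hx => ?_⟩
  · have e := bitNat_fin u ⟨i, hi⟩ ⟨p, hp⟩
    simp only at e
    rw [e]
    simp only [initState]
    cases h : u ⟨i, hi⟩ ⟨p, hp⟩ with
    | true => exact if_pos (Or.inl ⟨⟨i, hi⟩, ⟨p, hp⟩, rfl, h⟩)
    | false =>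
      refine if_neg ?_
      rintro (⟨i', p', h1, h2⟩ | ⟨i', p', h1, -⟩)
      · obtain ⟨h3, h4⟩ := eq_of_mul_add_eq hp p'.2 h1
        subst h3 h4
        rw [h] at h2
        exact Bool.noConfusion h2
      · have := lt hi hp
        omega
  · have e := bitNat_fin v ⟨i, hi⟩ ⟨p, hp⟩
    simp only at e
    rw [e]
    simp only [initState]
    cases h : v ⟨i, hi⟩ ⟨p, hp⟩ with
    | true => exact if_pos (Or.inr ⟨⟨i, hi⟩, ⟨p, hp⟩, rfl, h⟩)
    | false =>
      refine if_neg ?_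
      rintro (⟨i', p', h1, -⟩ | ⟨i', p', h1, h2⟩)
      · have := lt i'.2 p'.2
        omega
      · obtain ⟨h3, h4⟩ := eq_of_mul_add_eq hp p'.2 (i := i) (i' := i') (by omega)
        subst h3 h4
        rw [h] at h2
        exact Bool.noConfusion h2
  · exact dif_neg (by omega)
  · exact dif_neg (by omega)
  · simp only [initState]
    split_ifs <;> omega
  · refine if_neg ?_
    rintro (⟨i', p', h1, -⟩ | ⟨i', p', h1, -⟩)
    · have := lt i'.2 p'.2
      omega
    · have := lt i'.2 p'.2
      omega

theorem hasOrthogonalPair_iff {n d : ℕ} (u v : Fin n → Fin d → Bool) :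
    HasOrthogonalPair u v ↔
      ∃ i < n, ∃ j < n, ∀ p < d, ¬ (bitNat u i p = 1 ∧ bitNat v j p = 1) := by
  have key : ∀ i j : Fin n, ∑ k : Fin d, ((u i k).toNat : ℤ) * ((v j k).toNat : ℤ) = 0 ↔
      ∀ p < d, ¬ (bitNat u i p = 1 ∧ bitNat v j p = 1) := by
    intro i j
    rw [Finset.sum_eq_zero_iff_of_nonneg fun _ _ => by positivity]
    constructor
    · rintro h p hp ⟨h1, h2⟩
      have := h ⟨p, hp⟩ (Finset.mem_univ _)
      rw [bitNat_fin u i ⟨p, hp⟩] at h1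
      rw [bitNat_fin v j ⟨p, hp⟩] at h2
      rw [h1, h2] at this
      norm_num at this
    · intro h k _
      have := h k k.2
      rw [bitNat_fin, bitNat_fin] at this
      cases hu : u i k <;> cases hv : v j k <;> simp [hu, hv] at this ⊢
  unfold HasOrthogonalPair
  constructor
  · rintro ⟨i, j, h⟩
    exact ⟨i, i.2, j, j.2, (key i j).1 h⟩
  · rintro ⟨i, hi, j, hj, h⟩
    exact ⟨⟨i, hi⟩, ⟨j, hj⟩, (key ⟨i, hi⟩ ⟨j, hj⟩).2 h⟩

/-! ### Size of the numbers and total running time -/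

/-- A bound `n * D ^ (d + 1)` with constant `D` keeps bit lengths in `O(log n + d)`. The factor `8`
in `D` yields `8 ^ (d + 1) ≥ 8 * (d + 1)`, which absorbs the terms linear in `d`. -/
theorem fitting_of_base {s Δ M n d D : ℕ} (hs : 0 < s) (hΔ : 0 < Δ) (hM : 0 < M) (hn : 0 < n)
    (hD : D = 8 * (2 ^ (s + 1) * Δ * M)) :
    Fitting (n * D ^ (d + 1)) s Δ M n d (d / s + 1) (Δ ^ (d / s + 1)) (n * d + n * d) := by
  set D₀ := 2 ^ (s + 1) * Δ * M with hD₀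
  set P := D₀ ^ (d + 1) with hP
  have hD₀pos : 0 < D₀ := by positivity
  have two : 0 < 2 ^ s := by positivity
  have h8 : 8 * (d + 1) ≤ 8 ^ (d + 1) := by
    have : d + 1 ≤ 8 ^ d := Nat.lt_pow_self (by norm_num)
    rw [pow_succ]
    omega
  have hmain : n * (8 * (d + 1) * P) ≤ n * D ^ (d + 1) := by
    rw [hD, mul_pow]
    gcongr
  have hle : ∀ x, 0 < x → x ≤ D₀ → x ^ (d / s + 1) ≤ P := fun x hx hxD =>
    (Nat.pow_le_pow_right hx (by have := Nat.div_le_self d s; omega)).trans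
      (Nat.pow_le_pow_left hxD _)
  have hD₀P : D₀ ≤ P := Nat.le_self_pow (by omega) _
  have hPpos : 0 < P := by positivity
  have hm : d / s + 1 ≤ d + 1 := by have := Nat.div_le_self d s; omega
  have hms : (d / s + 1) * s ≤ d + s := by
    rw [add_mul, one_mul]
    have := Nat.div_mul_le_self d s
    omega
  have hsD : 2 ^ (s + 1) ≤ D₀ := by
    rw [hD₀, mul_assoc]; exact Nat.le_mul_of_pos_right _ (by positivity)
  have hMD : M ≤ D₀ := Nat.le_mul_of_pos_left _ (by positivity)
  have hΔD : 2 * (2 ^ s * Δ) ≤ D₀ := by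
    rw [hD₀, ← mul_assoc, ← pow_succ']; exact Nat.le_mul_of_pos_right _ hM
  have hΔD' : Δ ≤ D₀ := by
    have : Δ ≤ 2 ^ s * Δ := Nat.le_mul_of_pos_left _ two
    omega
  have hslt : s < 2 ^ s := Nat.lt_two_pow_self
  have hpow : 2 ^ (s + 1) = 2 ^ s * 2 := pow_succ _ _
  have hdP : d ≤ d * P := Nat.le_mul_of_pos_right _ hPpos
  have hnd : n * d ≤ n * (d * P) := by gcongr
  have hnP : P ≤ n * P := Nat.le_mul_of_pos_left _ hn
  have hn1 : n ≤ n * P := Nat.le_mul_of_pos_right _ hPpos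
  have hd1 : d ≤ n * (d * P) := hdP.trans (Nat.le_mul_of_pos_left _ hn)
  have hexp : n * (8 * (d + 1) * P) = 8 * (n * (d * P)) + 8 * (n * P) := by ring
  have hMP := hle M hM hMD
  have hΔP := hle Δ hΔ hΔD'
  have hnΔ : n * Δ ^ (d / s + 1) ≤ n * P := by gcongr
  exact ⟨hs, hΔ, Nat.succ_pos _, rfl, by omega, by omega, by omega, by omega, by omega, by omega,
    by omega, by omega, by omega⟩

theorem size_mul_pow_le (n D e : ℕ) : (n * D ^ e).size ≤ n.size + D.size * e := by
  rw [Nat.size_le, pow_add, pow_mul]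
  calc n * D ^ e ≤ n * (2 ^ D.size) ^ e := by
        gcongr
        exact (Nat.lt_size_self D).le
    _ < _ := Nat.mul_lt_mul_of_pos_right (Nat.lt_size_self n) (by positivity)

theorem size_le_log {n : ℕ} (hn : 0 < n) : (n.size : ℝ) ≤ 1 + 2 * Real.log n := by
  have h1 : 0 < n.size := Nat.size_pos.2 hn
  have h2 : 2 ^ (n.size - 1) ≤ n := Nat.lt_size.1 (by omega)
  have h3 : ((2 : ℝ) ^ (n.size - 1)) ≤ n := by exact_mod_cast h2
  have h4 := Real.log_le_log (by positivity) h3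
  rw [Real.log_pow, Nat.cast_sub (by omega), Nat.cast_one] at h4
  have h5 : (1 : ℝ) / 2 ≤ Real.log 2 := by linarith [Real.log_two_gt_d9]
  have h6 : (0 : ℝ) ≤ (n.size : ℝ) - 1 := by
    have : (1 : ℝ) ≤ n.size := by exact_mod_cast h1
    linarith
  nlinarith

/-- Since `log 1.155 ≥ 1 / 10`, both `d` and `log n` are `O(ℓ)`. One factor `1 + ℓ` pays for the
number of blocks, the other for the bit lengths. -/
theorem cost_bound {s k D : ℕ} (hk : (k : ℝ) ≤ (1.155 : ℝ) ^ s) (K n d : ℕ) (hn : 0 < n) :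
    ((K * (n * k ^ (d / s + 1) * (d / s + 1)) * unitCost (n * D ^ (d + 1)) : ℕ) : ℝ) ≤
      (K * k * 10 * (5 + 22 * D.size)) * ((n : ℝ) * (1.155 : ℝ) ^ d) *
        (1 + Real.log ((n : ℝ) * (1.155 : ℝ) ^ d)) ^ 2 := by
  have hn' : (1 : ℝ) ≤ n := by exact_mod_cast hn
  set ℓ := Real.log ((n : ℝ) * (1.155 : ℝ) ^ d) with hℓ
  have hℓ' : ℓ = Real.log n + d * Real.log 1.155 := by
    rw [hℓ, Real.log_mul (by positivity) (by positivity), Real.log_pow]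
  have hlog : (1 : ℝ) / 10 ≤ Real.log 1.155 := by
    have := Real.one_sub_inv_le_log_of_pos (show (0 : ℝ) < 1.155 by norm_num)
    norm_num at this ⊢
    linarith
  have hlogn : 0 ≤ Real.log n := Real.log_nonneg hn'
  have hd0 : (0 : ℝ) ≤ d := Nat.cast_nonneg d
  have hd : (d : ℝ) ≤ 10 * ℓ := by nlinarith
  have hnℓ : Real.log n ≤ ℓ := by nlinarith
  have hℓ0 : 0 ≤ ℓ := hlogn.trans hnℓ
  have hm : ((d / s + 1 : ℕ) : ℝ) ≤ 10 * (1 + ℓ) := by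
    have : ((d / s : ℕ) : ℝ) ≤ d := by exact_mod_cast Nat.div_le_self d s
    push_cast
    linarith
  -- The extra block costs only the constant factor `k`, and `s * (d / s) ≤ d` handles the others.
  have hpow : ((k ^ (d / s + 1) : ℕ) : ℝ) ≤ k * (1.155 : ℝ) ^ d := by
    push_cast
    rw [pow_succ, mul_comm]
    gcongr
    calc (k : ℝ) ^ (d / s) ≤ ((1.155 : ℝ) ^ s) ^ (d / s) := by gcongr
      _ = (1.155 : ℝ) ^ (s * (d / s)) := by rw [pow_mul]
      _ ≤ _ := pow_le_pow_right₀ (by norm_num) (Nat.mul_div_le d s)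
  have hunit : ((unitCost (n * D ^ (d + 1)) : ℕ) : ℝ) ≤ (5 + 22 * D.size) * (1 + ℓ) := by
    have h1 : ((n * D ^ (d + 1)).size : ℝ) ≤ n.size + D.size * (d + 1) := by
      exact_mod_cast size_mul_pow_le n D (d + 1)
    have h2 := size_le_log hn
    have h3 : (D.size : ℝ) * (d + 1) ≤ D.size * (11 * (1 + ℓ)) := by
      gcongr
      linarith
    unfold unitCost
    push_cast
    nlinarith
  calc ((K * (n * k ^ (d / s + 1) * (d / s + 1)) * unitCost (n * D ^ (d + 1)) : ℕ) : ℝ)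
      = K * (n * ((k ^ (d / s + 1) : ℕ) : ℝ) * ((d / s + 1 : ℕ) : ℝ)) *
          ((unitCost (n * D ^ (d + 1)) : ℕ) : ℝ) := by push_cast; ring
    _ ≤ K * (n * (k * (1.155 : ℝ) ^ d) * (10 * (1 + ℓ))) * ((5 + 22 * D.size) * (1 + ℓ)) := by
        gcongr
    _ = _ := by ring

end OrthogonalVectors

theorem mainTheorem9 :
    ∃ (p : LogRAM.Prog) (C : ℝ) (k : ℕ),
      OrthogonalVectors.SolvesInTime p fun n d =>
        C * ((n : ℝ) * (1.155 : ℝ) ^ d) * (1 + Real.log ((n : ℝ) * (1.155 : ℝ) ^ d)) ^ k := by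
  classical
  obtain ⟨s, k, M, A, B, hs, hk, hAB⟩ := exists_biclique_cover
  have hk0 : 0 < k := by
    obtain ⟨p, -⟩ := (hAB ∅ ∅).1 (Finset.disjoint_empty_left ∅)
    exact p.pos
  have hM0 : 0 < M := (A ∅ ⟨0, hk0⟩).pos
  obtain ⟨K, hK⟩ := OrthogonalVectors.runs_mainProg s k M (OrthogonalVectors.coverTable A B)
    fun x _ => OrthogonalVectors.coverTable_lt hk0 x
  set D := 8 * (2 ^ (s + 1) * k * M) with hD
  refine ⟨OrthogonalVectors.mainProg s k M (OrthogonalVectors.coverTable A B),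
    K * k * 10 * (5 + 22 * D.size), 2, fun n d hn u v => ?_⟩
  obtain ⟨l, μ', hrun⟩ := hK rfl (OrthogonalVectors.fitting_of_base hs hk0 hM0 hn hD)
    (OrthogonalVectors.input_initState u v) hn
  obtain ⟨t, τ, hex, ht, hτ⟩ := hrun (OrthogonalVectors.initState u v) (by
    refine ⟨fun r hr => ?_, rfl⟩
    change r < 13 at hr
    interval_cases r <;> rfl)
  refine ⟨t, τ, hex, ?_, ?_⟩
  · exact le_trans (by exact_mod_cast ht) (OrthogonalVectors.cost_bound hk K n d hn)
  · rw [hτ.1 0 (Nat.succ_pos _), List.getD_cons_zero]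
    refine if_congr ?_ rfl rfl
    rw [OrthogonalVectors.hasOrthogonalPair_iff]
    refine exists_congr fun i => and_congr_right fun _ => exists_congr fun j =>
      and_congr_right fun _ => ?_
    exact OrthogonalVectors.exists_code_eq_iff hs hk0 hAB (OrthogonalVectors.bitNat_le u i)
      (OrthogonalVectors.bitNat_le v j) fun p hp => dif_neg (by omega)
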